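/- Identify $\mathbb{R}^2$ with $\mathbb{C}$, put $(x_1,x_2)^\perp=(-x_2,x_1)$, and let $\mathbb{T}=\mathbb{R}/2\pi\mathbb{Z}$. Let $0<\delta\le 1$ and let $z,h:\mathbb{R}\to\mathbb{R}^2$ be curves of class $C^{2,\delta}$ with $z(\alpha+2\pi)=z(\alpha)+(2\pi,0)$ and $h(\alpha+2\pi)=h(\alpha)+(2\pi,0)$. Write $$\|z\|_{C^{2,\delta}}=\sup_{|\alpha|\le\pi}|z(\alpha)|+\sup_{\alpha}|\partial_\alpha z(\alpha)|+\sup_\alpha|\partial_\alpha^2z(\alpha)|+\sup_{\alpha\ne\beta}\frac{|\partial_\alpha^2z(\alpha)-\partial_\alpha^2z(\beta)|}{|\alpha-\beta|^\delta},$$ $$\mathcal F(z)(\alpha,\beta)=\frac{\beta^2}{|z(\alpha)-z(\alpha-\beta)|^2}\ (\beta\ne0),\qquad \mathcal F(z)(\alpha,0)=\frac1{|\partial_\alpha z(\alpha)|^2},\qquad d(z,h)(\alpha,\beta)=\frac1{|z(\alpha)-h(\beta)|^2},$$ with $L^\infty$ norms taken over $(\alpha,\beta)\in\mathbb{R}^2$,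 and similarly for $h$. For curves $x,y$ and a $2\pi$-periodic function $u$ let $$T^*_{x,y}(u)(\alpha)=-\frac1\pi\,PV\!\int_{\mathbb{R}}\frac{(x(\alpha)-y(\beta))^\perp\cdot\partial_\alpha y(\beta)}{|x(\alpha)-y(\beta)|^2}\,u(\beta)\,d\beta,$$ where $PV\int_{\mathbb R}=\lim_{\varepsilon\to0^+,\,R\to\infty}\int_{\varepsilon<|\alpha-\beta|<R}$, and let $$\mathcal T^*(u_1,u_2)=\big(T^*_{z,z}u_1+T^*_{z,h}u_2,\ T^*_{h,z}u_1+T^*_{h,h}u_2\big).$$ Suppose that $\|\mathcal F(z)\|_{L^\infty}<\infty$, $\|\mathcal F(h)\|_{L^\infty}<\infty$ and $\|d(z,h)\|_{L^\infty}<\infty$. Then for all $u_1,u_2\in L^2(\mathbb{T})$ the four principal values exist at every $\alpha$, $\mathcal T^*$ maps $L^2(\mathbb T)\times L^2(\mathbb T)$ into $H^1(\mathbb T)\times H^1(\mathbb T)$, and $$\|\mathcal T^*\|_{L^2\times L^2\to H^1\times H^1}\le C_h\,\|\mathcal F(z)\|_{L^\infty}^2\,\max\big(1,\|d(z,h)\|_{L^\infty}\big)^2\,\|z\|_{C^{2,\delta}}^2,\qquad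 C_h=C\,\|\mathcal F(h)\|_{L^\infty}^2\|h\|_{C^{2,\delta}}^2,$$ where the constant $C$ depends only on $\delta$, and the norm of a pair is the sum of the norms of its components. -/

import Mathlib

open MeasureTheory Filter Topology Set
open scoped ENNReal NNReal ContDiff Real

noncomputable section

namespace Muskat

/-! The plane `ℝ²` is identified with `ℂ`: the Euclidean norm is `‖·‖`, the dot product is
`inner ℝ`, and `(x₁, x₂)^⊥ = (-x₂, x₁)` is multiplication by `I`. -/

/-- Lebesgue measure on one period; it represents the measure on the circle `𝕋 = ℝ/2πℤ`. -/
def circleMeasure : Measure ℝ := volume.restrict (Ioc (-π) π)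

/-- A parametrized curve that is `2π`-periodic in the horizontal direction:
`z (α + 2π) = z α + (2π, 0)`. -/
def IsPeriodicCurve (z : ℝ → ℂ) : Prop :=
  ∀ α : ℝ, z (α + 2 * π) = z α + ((2 * π : ℝ) : ℂ)

/-- The norm `‖z‖_{C^{2,δ}}` of a periodic curve. Only the zeroth order term is not a periodic
function of the parameter; its supremum is taken over one period. -/
def holderNorm (δ : ℝ) (z : ℝ → ℂ) : ℝ≥0∞ :=
  (⨆ α ∈ Icc (-π) π, ‖z α‖ₑ) + (⨆ α : ℝ, ‖deriv z α‖ₑ) + (⨆ α : ℝ, ‖deriv (deriv z) α‖ₑ)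
    + ⨆ (α : ℝ) (β : ℝ), ‖deriv (deriv z) α - deriv (deriv z) β‖ₑ / ‖α - β‖ₑ ^ δ

/-- `z ∈ C^{2,δ}`. -/
def IsC2Holder (δ : ℝ) (z : ℝ → ℂ) : Prop :=
  ContDiff ℝ 2 z ∧ holderNorm δ z < ⊤

/-- The arc-chord function `F(z)(α, β) = β² / |z(α) - z(α - β)|²`, extended to `β = 0` by
`1 / |∂z(α)|²`; it takes the value `∞` where the denominator vanishes. -/
def arcChord (z : ℝ → ℂ) (α β : ℝ) : ℝ≥0∞ :=
  if β = 0 then 1 / ‖deriv z α‖ₑ ^ 2 else ‖β‖ₑ ^ 2 / ‖z α - z (α - β)‖ₑ ^ 2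

/-- `‖F(z)‖_{L^∞}`. -/
def arcChordNorm (z : ℝ → ℂ) : ℝ≥0∞ := ⨆ (α : ℝ) (β : ℝ), arcChord z α β

/-- `‖d(z,h)‖_{L^∞}` where `d(z,h)(α, β) = 1 / |z(α) - h(β)|²`. -/
def distNorm (z h : ℝ → ℂ) : ℝ≥0∞ := ⨆ (α : ℝ) (β : ℝ), 1 / ‖z α - h β‖ₑ ^ 2

/-- The set `{β : ε < |α - β| < R}` over which a principal value at `α` is truncated. -/
def pvSet (α ε R : ℝ) : Set ℝ := {β : ℝ | ε < |α - β| ∧ |α - β| < R}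

/-- `v` is the principal value (at `β = α` and at infinity) of `∫_ℝ g(β) dβ`. -/
def HasPV (g : ℝ → ℝ) (α v : ℝ) : Prop :=
  (∀ ε R : ℝ, 0 < ε → IntegrableOn g (pvSet α ε R)) ∧
    Tendsto (fun p : ℝ × ℝ => ∫ β in pvSet α p.1 p.2, g β) (𝓝[>] 0 ×ˢ atTop) (𝓝 v)

/-- The principal value of `∫_ℝ g(β) dβ`; meaningful when `HasPV g α v` for some `v`. -/
def pv (g : ℝ → ℝ) (α : ℝ) : ℝ :=
  limUnder (𝓝[>] 0 ×ˢ atTop) (fun p : ℝ × ℝ => ∫ β in pvSet α p.1 p.2, g β)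

/-- The integrand `(x(α) - y(β))^⊥ · ∂y(β) / |x(α) - y(β)|² u(β)`. -/
def adjIntegrand (x y : ℝ → ℂ) (u : ℝ → ℝ) (α β : ℝ) : ℝ :=
  inner ℝ (Complex.I * (x α - y β)) (deriv y β) / ‖x α - y β‖ ^ 2 * u β

/-- `-(1/π) PV ∫_ℝ (x(α) - y(β))^⊥ · ∂y(β) / |x(α) - y(β)|² u(β) dβ`. The four entries are
`T₁* = adjEntry z z`, `T₂* = adjEntry h z`, `T₃* = adjEntry z h`, `T₄* = adjEntry h h`. -/
def adjEntry (x y : ℝ → ℂ) (u : ℝ → ℝ) (α : ℝ) : ℝ :=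
  -(1 / π) * pv (adjIntegrand x y u α) α

/-- First component `T₁* u₁ + T₃* u₂` of `𝒯*(u₁, u₂)`. -/
def adjFst (z h : ℝ → ℂ) (u₁ u₂ : ℝ → ℝ) (α : ℝ) : ℝ :=
  adjEntry z z u₁ α + adjEntry z h u₂ α

/-- Second component `T₂* u₁ + T₄* u₂` of `𝒯*(u₁, u₂)`. -/
def adjSnd (z h : ℝ → ℂ) (u₁ u₂ : ℝ → ℝ) (α : ℝ) : ℝ :=
  adjEntry h z u₁ α + adjEntry h h u₂ α

/-- `u ∈ L²(𝕋)`, as a `2π`-periodic function on `ℝ`. -/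
def MemL2 (u : ℝ → ℝ) : Prop :=
  Function.Periodic u (2 * π) ∧ MemLp u 2 circleMeasure

/-- `‖u‖_{L²(𝕋)}`. -/
def l2Norm (u : ℝ → ℝ) : ℝ≥0∞ := eLpNorm u 2 circleMeasure

/-- `g` is the weak derivative of `f` on `𝕋`. -/
def IsWeakDeriv (f g : ℝ → ℝ) : Prop :=
  ∀ φ : ℝ → ℝ, ContDiff ℝ ∞ φ → Function.Periodic φ (2 * π) →
    ∫ x, f x * deriv φ x ∂circleMeasure = -∫ x, g x * φ x ∂circleMeasure

/-- `f ∈ H¹(𝕋)`. -/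
def MemH1 (f : ℝ → ℝ) : Prop :=
  MemL2 f ∧ ∃ g : ℝ → ℝ, MemL2 g ∧ IsWeakDeriv f g

/-- `‖f‖_{H¹(𝕋)} = (‖f‖² + ‖∂f‖²)^{1/2}`, and `∞` if there is no weak derivative in `L²`. Weak
derivatives of `f` agree almost everywhere, so the infimum is over at most one value. -/
def h1Norm (f : ℝ → ℝ) : ℝ≥0∞ :=
  ⨅ (g : ℝ → ℝ) (_ : MemL2 g ∧ IsWeakDeriv f g), (l2Norm f ^ 2 + l2Norm g ^ 2) ^ (1 / 2 : ℝ)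

end Muskat

end

/-! The kernel of `T*_{x,y}` is the imaginary part of `∂y(β) / (x(α) - y(β))`. At infinity it
behaves like `Im ∂y(β) / (α - β)`, and `1 / (α - β)` is replaced by an odd function of `α - β` that
vanishes near `0` and is constant on intervals of one period. The principal value of this function
against a periodic density `v` is zero, because `v(α - s) - v(α + s)` has mean zero; the remainder
of the kernel decays like `(α - β)⁻²`. On the diagonal of a single curve the singularity of the
complex quotient is `1 / (α - β)`, which is real, so the kernel stays bounded.

The derivative of the kernel in `α` is bounded by an integrable function of `α - β`: for separated
curves it is bounded and decays quadratically; for a single curve its singular part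
`-1 / (α - β)²` is again real, and the trapezoid rule for `C^{2,δ}` curves leaves only
`|α - β|^(δ - 1)`. Young's inequality bounds both the operator and its formal derivative on `L²`,
and integration by parts against a periodic test function identifies the latter as the weak
derivative. -/

namespace Muskat

/-! ### Periodic functions on the line -/

section Periodic

variable {T a : ℝ}

lemma isAddFundamentalDomain_zmultiples {G : Type*} [AddCommGroup G] [MeasurableSpace G]
    {μ : Measure G} {g : G} {s : Set G} (hs : NullMeasurableSet s μ)
    (h : ∀ x, ∃! n : ℤ, x + n • g ∈ s) :
    IsAddFundamentalDomain (AddSubgroup.zmultiples g) s μ := by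
  refine .mk' hs fun x => ?_
  obtain ⟨n, hn, hn_unique⟩ := h x
  refine ⟨⟨n • g, n, rfl⟩, show n • g + x ∈ s by rwa [add_comm], ?_⟩
  rintro ⟨_, m, rfl⟩ (hm : m • g + x ∈ s)
  have hmn : m = n := hn_unique m (by rwa [add_comm] at hm)
  simp only [hmn]

lemma isAddFundamentalDomain_Ioc_prod_univ (hT : 0 < T) (a : ℝ) :
    IsAddFundamentalDomain (AddSubgroup.zmultiples ((T, T) : ℝ × ℝ))
      (Ioc a (a + T) ×ˢ (univ : Set ℝ)) :=
  isAddFundamentalDomain_zmultiples (measurableSet_Ioc.prod .univ).nullMeasurableSet fun x => by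
    simpa using existsUnique_add_zsmul_mem_Ioc hT x.1 a

lemma isAddFundamentalDomain_univ_prod_Ioc (hT : 0 < T) (a : ℝ) :
    IsAddFundamentalDomain (AddSubgroup.zmultiples ((T, T) : ℝ × ℝ))
      ((univ : Set ℝ) ×ˢ Ioc a (a + T)) :=
  isAddFundamentalDomain_zmultiples (MeasurableSet.univ.prod measurableSet_Ioc).nullMeasurableSet
    fun x => by simpa using existsUnique_add_zsmul_mem_Ioc hT x.2 a

/-- Both strips of width `T` are fundamental domains of the diagonal translation by `(T, T)`. -/
lemma lintegral_lintegral_swap_of_periodic (hT : 0 < T) {H : ℝ × ℝ → ℝ≥0∞}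
    (hH : Function.Periodic H (T, T)) (hm : AEMeasurable H) :
    ∫⁻ x in Ioc a (a + T), ∫⁻ y, H (x, y) = ∫⁻ y in Ioc a (a + T), ∫⁻ x, H (x, y) := by
  have h := (isAddFundamentalDomain_Ioc_prod_univ hT a).setLIntegral_eq
    (isAddFundamentalDomain_univ_prod_Ioc hT a) H hH.map_vadd_zmultiples
  rw [Measure.volume_eq_prod, setLIntegral_prod H hm.restrict,
    setLIntegral_prod_symm H hm.restrict] at h
  simpa only [setLIntegral_univ] using h

lemma integral_integral_swap_of_periodic (hT : 0 < T) {E : Type*} [NormedAddCommGroup E]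
    [NormedSpace ℝ E] {H : ℝ × ℝ → E} (hH : Function.Periodic H (T, T))
    (hi : IntegrableOn H (Ioc a (a + T) ×ˢ univ)) :
    ∫ x in Ioc a (a + T), ∫ y, H (x, y) = ∫ y in Ioc a (a + T), ∫ x, H (x, y) := by
  have hdom := isAddFundamentalDomain_Ioc_prod_univ hT a
  have hdom' := isAddFundamentalDomain_univ_prod_Ioc hT a
  have hi' : IntegrableOn H (univ ×ˢ Ioc a (a + T)) :=
    (hdom.integrableOn_iff hdom' hH.map_vadd_zmultiples).1 hi
  have h := hdom.setIntegral_eq hdom' hH.map_vadd_zmultiples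
  simp only [IntegrableOn, Measure.volume_eq_prod, ← Measure.prod_restrict,
    Measure.restrict_univ] at hi hi' h
  rwa [integral_prod H hi, integral_prod_symm H hi'] at h

lemma locallyIntegrable_of_periodic {E : Type*} [NormedAddCommGroup E] {v : ℝ → E} (hT : 0 < T)
    (hper : Function.Periodic v T) (hv : IntegrableOn v (Ioc a (a + T))) :
    LocallyIntegrable v := by
  rw [locallyIntegrable_iff]
  intro K hK
  obtain ⟨b, c, hbc⟩ := bddBelow_bddAbove_iff_subset_Icc.1 ⟨hK.bddBelow, hK.bddAbove⟩
  have hint := hper.intervalIntegrable (t := a) hT.ne'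
    ((intervalIntegrable_iff_integrableOn_Ioc_of_le (by linarith)).2 hv) (min b c) (max b c)
  rw [intervalIntegrable_iff_integrableOn_Icc_of_le min_le_max] at hint
  exact hint.mono_set (hbc.trans (Icc_subset_Icc (min_le_left b c) (le_max_right b c)))

lemma lintegral_convolution_of_periodic (hT : 0 < T) {k w : ℝ → ℝ≥0∞} (hk : Measurable k)
    (hw : AEMeasurable w) (hper : Function.Periodic w T) :
    ∫⁻ x in Ioc a (a + T), ∫⁻ y, k (x - y) * w y =
      (∫⁻ s, k s) * ∫⁻ y in Ioc a (a + T), w y := by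
  have hH : Function.Periodic (fun p : ℝ × ℝ => k (p.1 - p.2) * w p.2) (T, T) := fun p => by
    simp only [Prod.fst_add, Prod.snd_add, add_sub_add_right_eq_sub, hper p.2]
  have hm : AEMeasurable (fun p : ℝ × ℝ => k (p.1 - p.2) * w p.2) :=
    (by fun_prop : Measurable fun p : ℝ × ℝ => k (p.1 - p.2)).aemeasurable.mul hw.comp_snd
  rw [lintegral_lintegral_swap_of_periodic hT hH hm, ← lintegral_const_mul'' _ hw.restrict]
  refine lintegral_congr fun y => ?_
  simp only [lintegral_mul_const _ (by fun_prop : Measurable fun x => k (x - y)),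
    lintegral_sub_right_eq_self k y]

lemma integrableOn_prod_convolution_of_periodic (hT : 0 < T) {k v : ℝ → ℝ} (hk : Measurable k)
    (hki : Integrable k) (hper : Function.Periodic v T) (hv : LocallyIntegrable v) :
    IntegrableOn (fun p : ℝ × ℝ => k (p.1 - p.2) * v p.2) (Ioc a (a + T) ×ˢ univ) := by
  have hkm : Measurable fun p : ℝ × ℝ => k (p.1 - p.2) := by fun_prop
  have hm : AEStronglyMeasurable (fun p : ℝ × ℝ => k (p.1 - p.2) * v p.2) :=
    hkm.aestronglyMeasurable.mul hv.aestronglyMeasurable.comp_snd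
  refine ⟨hm.restrict, ?_⟩
  have hT' : ∫⁻ x in Ioc a (a + T), ∫⁻ y, ‖k (x - y)‖ₑ * ‖v y‖ₑ < ⊤ := by
    rw [lintegral_convolution_of_periodic hT hk.enorm hv.aestronglyMeasurable.enorm
      (hper.comp fun y => ‖y‖ₑ)]
    exact ENNReal.mul_lt_top hki.2
      ((hv.integrableOn_isCompact isCompact_Icc).mono_set Ioc_subset_Icc_self).2
  rw [HasFiniteIntegral, Measure.volume_eq_prod, setLIntegral_prod _ hm.enorm.restrict]
  simpa only [setLIntegral_univ, enorm_mul] using hT'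

lemma rpow_lintegral_mul_le {X : Type*} [MeasurableSpace X] {μ : Measure X} {k w : X → ℝ≥0∞}
    {p : ℝ} (hp : 1 ≤ p) (hk : Measurable k) (hw : AEMeasurable w μ) :
    (∫⁻ x, k x * w x ∂μ) ^ p ≤ (∫⁻ x, k x ∂μ) ^ (p - 1) * ∫⁻ x, k x * w x ^ p ∂μ := by
  have hp0 : 0 < p := by linarith
  have hwk : AEMeasurable w (μ.withDensity k) := hw.mono_ac (withDensity_absolutelyContinuous _ _)
  have h := ENNReal.rpow_le_rpow (eLpNorm'_le_eLpNorm'_mul_rpow_measure_univ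
    (μ := μ.withDensity k) (f := w) one_pos hp hwk.aestronglyMeasurable) hp0.le
  simp only [eLpNorm', enorm_eq_self, ENNReal.rpow_one, div_one,
    withDensity_apply _ MeasurableSet.univ, setLIntegral_univ,
    ENNReal.mul_rpow_of_nonneg _ _ hp0.le, ← ENNReal.rpow_mul, one_div, inv_mul_cancel₀ hp0.ne',
    sub_mul, one_mul] at h
  rwa [lintegral_withDensity_eq_lintegral_mul₀ hk.aemeasurable hw,
    lintegral_withDensity_eq_lintegral_mul₀ hk.aemeasurable (hw.pow_const p),
    mul_comm (∫⁻ x, _ ∂μ)] at h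

lemma lintegral_rpow_convolution_le_of_periodic (hT : 0 < T) {k w : ℝ → ℝ≥0∞} {p : ℝ} (hp : 1 ≤ p)
    (hk : Measurable k) (hw : AEMeasurable w) (hper : Function.Periodic w T) :
    ∫⁻ x in Ioc a (a + T), (∫⁻ y, k (x - y) * w y) ^ p ≤
      (∫⁻ s, k s) ^ p * ∫⁻ y in Ioc a (a + T), w y ^ p := by
  have hm : AEMeasurable fun p' : ℝ × ℝ => k (p'.1 - p'.2) * w p'.2 ^ p :=
    (by fun_prop : Measurable fun p' : ℝ × ℝ => k (p'.1 - p'.2)).aemeasurable.mul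
      (hw.pow_const p).comp_snd
  calc ∫⁻ x in Ioc a (a + T), (∫⁻ y, k (x - y) * w y) ^ p
      ≤ ∫⁻ x in Ioc a (a + T), (∫⁻ s, k s) ^ (p - 1) * ∫⁻ y, k (x - y) * w y ^ p :=
        lintegral_mono fun x => by
          simpa only [lintegral_sub_left_eq_self k x] using
            rpow_lintegral_mul_le hp (by fun_prop : Measurable fun y => k (x - y)) hw
    _ = (∫⁻ s, k s) ^ (p - 1) * ((∫⁻ s, k s) * ∫⁻ y in Ioc a (a + T), w y ^ p) := by
        rw [lintegral_const_mul'' _ hm.lintegral_prod_right'.restrict,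
          lintegral_convolution_of_periodic hT hk (hw.pow_const p) (hper.comp (· ^ p))]
    _ = (∫⁻ s, k s) ^ p * ∫⁻ y in Ioc a (a + T), w y ^ p := by
        rw [← mul_assoc]
        congr 1
        conv_lhs => rw [← ENNReal.rpow_one (∫⁻ s, k s), ← ENNReal.rpow_mul, one_mul]
        rw [← ENNReal.rpow_add_of_nonneg _ _ (by linarith) zero_le_one, sub_add_cancel]

lemma eLpNorm_le_of_enorm_le_convolution (hT : 0 < T) {k : ℝ → ℝ≥0∞} {f u : ℝ → ℝ} {p : ℝ≥0∞}
    (hp : 1 ≤ p) (hp_top : p ≠ ⊤) (hk : Measurable k) (hu : AEStronglyMeasurable u)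
    (hper : Function.Periodic u T) (hf : ∀ x, ‖f x‖ₑ ≤ ∫⁻ y, k (x - y) * ‖u y‖ₑ) :
    eLpNorm f p (volume.restrict (Ioc a (a + T))) ≤
      (∫⁻ s, k s) * eLpNorm u p (volume.restrict (Ioc a (a + T))) := by
  have hp0 : p ≠ 0 := (one_pos.trans_le hp).ne'
  have hp1 : 1 ≤ p.toReal := by simpa using ENNReal.toReal_mono hp_top hp
  have hp1' : 0 < p.toReal := one_pos.trans_le hp1
  rw [eLpNorm_eq_lintegral_rpow_enorm_toReal hp0 hp_top,
    eLpNorm_eq_lintegral_rpow_enorm_toReal hp0 hp_top, one_div, ENNReal.rpow_inv_le_iff hp1',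
    ENNReal.mul_rpow_of_nonneg _ _ hp1'.le, ← ENNReal.rpow_mul, inv_mul_cancel₀ hp1'.ne',
    ENNReal.rpow_one]
  exact (lintegral_mono fun x => ENNReal.rpow_le_rpow (hf x) hp1'.le).trans
    (lintegral_rpow_convolution_le_of_periodic hT hp1 hk hu.enorm (hper.comp fun y => ‖y‖ₑ))

end Periodic

/-- The Cauchy (Lorentz) profile of width `R`, the model decay of all remainder kernels. -/
noncomputable def cauchyWeight (R s : ℝ) : ℝ := (1 + (s / R) ^ 2)⁻¹

lemma cauchyWeight_pos (R s : ℝ) : 0 < cauchyWeight R s := by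
  unfold cauchyWeight; positivity

lemma measurable_cauchyWeight (R : ℝ) : Measurable (cauchyWeight R) := by
  unfold cauchyWeight; fun_prop

lemma integrable_cauchyWeight {R : ℝ} (hR : R ≠ 0) : Integrable (cauchyWeight R) :=
  integrable_inv_one_add_sq.comp_div hR

lemma integral_cauchyWeight {R : ℝ} (hR : 0 < R) : ∫ s, cauchyWeight R s = π * R := by
  rw [show (∫ s, cauchyWeight R s) = |R| • ∫ s : ℝ, (1 + s ^ 2)⁻¹ from
    Measure.integral_comp_div (fun s : ℝ => (1 + s ^ 2)⁻¹) R, integral_univ_inv_one_add_sq,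
    abs_of_pos hR, smul_eq_mul, mul_comm]

lemma cauchyWeight_add_le (R s t : ℝ) :
    cauchyWeight R (s + t) ≤ 2 * (1 + (s / R) ^ 2) * cauchyWeight R t := by
  unfold cauchyWeight
  rw [← div_eq_mul_inv, inv_le_comm₀ (by positivity) (by positivity), inv_div,
    div_le_iff₀ (by positivity), add_div]
  nlinarith [sq_nonneg (s / R + t / R + s / R), mul_nonneg (sq_nonneg (s / R + t / R))
    (sq_nonneg (s / R))]

lemma integrable_cauchyWeight_mul_of_periodic {T R : ℝ} (hT : 0 < T) (hR : R ≠ 0) {v : ℝ → ℝ}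
    (hper : Function.Periodic v T) (hv : LocallyIntegrable v) (x : ℝ) :
    Integrable fun y => cauchyWeight R (x - y) * v y := by
  have hprod := integrableOn_prod_convolution_of_periodic (a := 0) hT (measurable_cauchyWeight R)
    (integrable_cauchyWeight hR) hper hv
  rw [IntegrableOn, Measure.volume_eq_prod, ← Measure.prod_restrict, Measure.restrict_univ] at hprod
  have : (ae (volume.restrict (Ioc 0 (0 + T)))).NeBot := by
    rw [ae_restrict_neBot]; simpa using hT
  obtain ⟨c, hc⟩ := hprod.prod_right_ae.exists
  refine (hc.norm.const_mul (2 * (1 + ((x - c) / R) ^ 2))).mono'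
    (((measurable_cauchyWeight R).comp (by fun_prop)).aestronglyMeasurable.mul
      hv.aestronglyMeasurable) (Eventually.of_forall fun y => ?_)
  have hle := cauchyWeight_add_le R (x - c) (c - y)
  rw [sub_add_sub_cancel] at hle
  rw [norm_mul, norm_mul, ← mul_assoc, Real.norm_of_nonneg (cauchyWeight_pos R _).le,
    Real.norm_of_nonneg (cauchyWeight_pos R _).le]
  gcongr

/-! ### A step function comparable to the reciprocal -/

/-- The odd function equal to `1 / (T n)` on `[T n, T (n + 1))` for `n ≥ 1` and to `0` on `[0, T)`.
For every `s` one of the two floors is `0`, and the corresponding reciprocal is the junk value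
`0⁻¹ = 0`. Subtracting it from `1 / s` leaves an integrable tail, and it integrates to `0` against
mean zero `T`-periodic functions over whole periods. -/
noncomputable def stepRecip (T s : ℝ) : ℝ := (T * ⌊s / T⌋₊)⁻¹ - (T * ⌊-s / T⌋₊)⁻¹

section StepRecip

variable {T : ℝ}

lemma measurable_stepRecip (T : ℝ) : Measurable (stepRecip T) := by
  have h : Measurable fun x : ℝ => (⌊x⌋₊ : ℝ) :=
    (measurable_from_top (f := fun n : ℕ => (n : ℝ))).comp Nat.measurable_floor
  exact ((h.comp (measurable_id.div_const T)).const_mul T).inv.sub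
    ((h.comp (measurable_neg.div_const T)).const_mul T).inv

lemma stepRecip_neg (T s : ℝ) : stepRecip T (-s) = -stepRecip T s := by
  simp only [stepRecip, neg_neg, neg_sub]

lemma abs_stepRecip_neg (T s : ℝ) : |stepRecip T (-s)| = |stepRecip T s| := by
  rw [stepRecip_neg, abs_neg]

lemma stepRecip_eq (hT : 0 < T) {n : ℕ} {s : ℝ} (h1 : T * n ≤ s) (h2 : s < T * (n + 1)) :
    stepRecip T s = (T * n)⁻¹ := by
  have hs : 0 ≤ s := le_trans (by positivity) h1
  have hn : ⌊s / T⌋₊ = n := by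
    rw [Nat.floor_eq_iff (by positivity), le_div_iff₀ hT, div_lt_iff₀ hT]
    constructor <;> linarith
  have h0 : ⌊-s / T⌋₊ = 0 :=
    Nat.floor_of_nonpos (div_nonpos_of_nonpos_of_nonneg (by linarith) hT.le)
  simp [stepRecip, hn, h0]

lemma exists_nat_mul_le_lt (hT : 0 < T) {s : ℝ} (hs : 0 ≤ s) :
    ∃ n : ℕ, T * n ≤ s ∧ s < T * (n + 1) := by
  refine ⟨⌊s / T⌋₊, ?_, ?_⟩
  · simpa [mul_comm] using (le_div_iff₀ hT).1 (Nat.floor_le (div_nonneg hs hT.le))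
  · simpa [mul_comm] using (div_lt_iff₀ hT).1 (Nat.lt_floor_add_one (s / T))

lemma stepRecip_eq_zero (hT : 0 < T) {s : ℝ} (hs : |s| < T) : stepRecip T s = 0 := by
  wlog h0 : 0 ≤ s generalizing s
  · simpa [stepRecip_neg] using this (s := -s) (by simpa using hs) (by linarith)
  rw [stepRecip_eq hT (n := 0) (by simpa using h0) (by simpa using lt_of_abs_lt hs)]
  simp

lemma abs_stepRecip_le (hT : 0 < T) (s : ℝ) : |stepRecip T s| ≤ T⁻¹ := by
  wlog h0 : 0 ≤ s generalizing s
  · exact abs_stepRecip_neg T s ▸ this (-s) (by linarith)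
  obtain ⟨n, hn, hn'⟩ := exists_nat_mul_le_lt hT h0
  rw [stepRecip_eq hT hn hn', abs_of_nonneg (by positivity)]
  rcases n.eq_zero_or_pos with rfl | hpos
  · simpa using hT.le
  · exact inv_anti₀ hT (le_mul_of_one_le_right hT.le (by exact_mod_cast hpos))

lemma abs_inv_sub_stepRecip_le (hT : 0 < T) {s : ℝ} (hs : T ≤ |s|) :
    |s⁻¹ - stepRecip T s| ≤ 2 * T / s ^ 2 := by
  wlog h0 : 0 ≤ s generalizing s
  · have h := this (s := -s) (by simpa using hs) (by linarith)
    rwa [stepRecip_neg, inv_neg, neg_sq, ← neg_sub', abs_neg] at h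
  rw [abs_of_nonneg h0] at hs
  have hs0 : 0 < s := hT.trans_le hs
  obtain ⟨n, hn, hn'⟩ := exists_nat_mul_le_lt hT h0
  have hn1 : (1 : ℝ) ≤ n := by
    have : (0 : ℝ) < n := by nlinarith
    exact_mod_cast this
  have hhalf : s ≤ 2 * (T * n) := by nlinarith
  rw [stepRecip_eq hT hn hn', abs_sub_comm,
    abs_of_nonneg (sub_nonneg.2 (inv_anti₀ (by positivity) hn)),
    inv_sub_inv (by positivity) hs0.ne', div_le_div_iff₀ (by positivity) (by positivity)]
  calc (s - T * n) * s ^ 2 ≤ T * (s * s) := by rw [sq]; gcongr; linarith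
    _ ≤ T * (2 * (T * n) * s) := by gcongr
    _ = 2 * T * (T * n * s) := by ring

lemma tendsto_stepRecip_cobounded (hT : 0 < T) :
    Tendsto (stepRecip T) (Bornology.cobounded ℝ) (𝓝 0) := by
  have hinv : Tendsto (fun s : ℝ => s⁻¹) (Bornology.cobounded ℝ) (𝓝 0) := tendsto_inv₀_cobounded
  have hsub : Tendsto (fun s => s⁻¹ - stepRecip T s) (Bornology.cobounded ℝ) (𝓝 0) := by
    have hsq := (hinv.pow 2).const_mul (2 * T)
    rw [zero_pow two_ne_zero, mul_zero] at hsq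
    refine squeeze_zero_norm' ?_ hsq
    filter_upwards [eventually_cobounded_le_norm T] with s hs
    simpa only [div_eq_mul_inv, inv_pow, Real.norm_eq_abs] using abs_inv_sub_stepRecip_le hT hs
  simpa using hinv.sub hsub

lemma locallyIntegrable_stepRecip_comp_mul (hT : 0 < T) {v f : ℝ → ℝ} (hv : LocallyIntegrable v)
    (hf : Measurable f) : LocallyIntegrable fun s => stepRecip T (f s) * v s := by
  refine (hv.smul T⁻¹).mono (((measurable_stepRecip T).comp hf).aestronglyMeasurable.mul
    hv.aestronglyMeasurable) (Eventually.of_forall fun s => ?_)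
  rw [Pi.smul_apply, smul_eq_mul, norm_mul, norm_mul, Real.norm_of_nonneg (inv_nonneg.2 hT.le)]
  exact mul_le_mul_of_nonneg_right (abs_stepRecip_le hT _) (norm_nonneg _)

lemma intervalIntegrable_of_locallyIntegrable {v : ℝ → ℝ} (hv : LocallyIntegrable v) (a b : ℝ) :
    IntervalIntegrable v volume a b :=
  (hv.integrableOn_isCompact isCompact_uIcc).intervalIntegrable

lemma integral_period_mul_nat {w : ℝ → ℝ} (hper : Function.Periodic w T) (n : ℕ) :
    ∫ s in (T * n)..(T * (n + 1)), w s = ∫ s in 0..T, w s := by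
  simpa [mul_add] using hper.intervalIntegral_add_eq (T * n) 0

lemma integral_stepRecip_mul_of_le (hT : 0 < T) (w : ℝ → ℝ) {n : ℕ} {R : ℝ} (h1 : T * n ≤ R)
    (h2 : R ≤ T * (n + 1)) :
    ∫ s in (T * n)..R, stepRecip T s * w s = (T * n)⁻¹ * ∫ s in (T * n)..R, w s := by
  rw [← intervalIntegral.integral_const_mul]
  refine intervalIntegral.integral_congr_Ioo_of_le h1 fun s hs => ?_
  simp only [stepRecip_eq hT hs.1.le (hs.2.trans_le h2)]

lemma integral_stepRecip_mul_periods (hT : 0 < T) {w : ℝ → ℝ} (hper : Function.Periodic w T)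
    (hw : LocallyIntegrable w) (h0 : ∫ s in 0..T, w s = 0) (n : ℕ) :
    ∫ s in 0..(T * n), stepRecip T s * w s = 0 := by
  have hσw := intervalIntegrable_of_locallyIntegrable
    (locallyIntegrable_stepRecip_comp_mul hT hw measurable_id)
  simp only [id_eq] at hσw
  induction n with
  | zero => simp
  | succ n ih =>
    push_cast
    rw [← intervalIntegral.integral_add_adjacent_intervals (hσw 0 (T * n)) (hσw _ _), ih,
      integral_stepRecip_mul_of_le hT w (by gcongr; simp) le_rfl, integral_period_mul_nat hper n,
      h0, zero_add, mul_zero]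

lemma abs_integral_stepRecip_mul_le (hT : 0 < T) {w : ℝ → ℝ} (hper : Function.Periodic w T)
    (hw : LocallyIntegrable w) (h0 : ∫ s in 0..T, w s = 0) {R : ℝ} (hR : 0 ≤ R) :
    |∫ s in 0..R, stepRecip T s * w s| ≤ |stepRecip T R| * ∫ s in 0..T, |w s| := by
  have hσw := intervalIntegrable_of_locallyIntegrable
    (locallyIntegrable_stepRecip_comp_mul hT hw measurable_id)
  simp only [id_eq] at hσw
  obtain ⟨n, hn, hn'⟩ := exists_nat_mul_le_lt hT hR
  rw [← intervalIntegral.integral_add_adjacent_intervals (hσw 0 (T * n)) (hσw _ _),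
    integral_stepRecip_mul_periods hT hper hw h0, zero_add,
    integral_stepRecip_mul_of_le hT w hn hn'.le, stepRecip_eq hT hn hn', abs_mul,
    ← integral_period_mul_nat (w := fun s => |w s|) (hper.comp abs) n]
  refine mul_le_mul_of_nonneg_left ?_ (abs_nonneg _)
  exact (intervalIntegral.abs_integral_le_integral_abs hn).trans
    (intervalIntegral.integral_mono_interval le_rfl hn hn'.le
      (Eventually.of_forall fun s => abs_nonneg (w s))
      (intervalIntegrable_of_locallyIntegrable hw _ _).abs)

lemma tendsto_integral_stepRecip_mul (hT : 0 < T) {w : ℝ → ℝ} (hper : Function.Periodic w T)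
    (hw : LocallyIntegrable w) (h0 : ∫ s in 0..T, w s = 0) :
    Tendsto (fun R => ∫ s in 0..R, stepRecip T s * w s) atTop (𝓝 0) := by
  have hlim := ((tendsto_stepRecip_cobounded hT).mono_left
    IsOrderBornology.atTop_le_cobounded).abs.mul_const (∫ s in 0..T, |w s|)
  rw [abs_zero, zero_mul] at hlim
  refine squeeze_zero_norm' ?_ hlim
  filter_upwards [eventually_ge_atTop 0] with R hR
  exact abs_integral_stepRecip_mul_le hT hper hw h0 hR

lemma integral_stepRecip_convolution (hT : 0 < T) {v : ℝ → ℝ} (hv : LocallyIntegrable v)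
    (x R : ℝ) :
    ∫ y in (x - R)..(x + R), stepRecip T (x - y) * v y =
      ∫ s in 0..R, stepRecip T s * (v (x - s) - v (x + s)) := by
  have hi : ∀ a b, IntervalIntegrable (fun y => stepRecip T (x - y) * v y) volume a b :=
    intervalIntegrable_of_locallyIntegrable
      (locallyIntegrable_stepRecip_comp_mul hT hv (measurable_const.sub measurable_id))
  have hleft : IntervalIntegrable (fun s => stepRecip T s * v (x - s)) volume 0 R := by
    simpa using (hi x (x - R)).comp_sub_left x
  have hright : IntervalIntegrable (fun s => stepRecip T s * v (x + s)) volume 0 R := by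
    simpa [stepRecip_neg, Pi.neg_def] using ((hi x (x + R)).comp_add_left x).neg
  have eleft : ∫ y in (x - R)..x, stepRecip T (x - y) * v y =
      ∫ s in 0..R, stepRecip T s * v (x - s) := by
    simpa using (intervalIntegral.integral_comp_sub_left (a := 0) (b := R)
      (fun y => stepRecip T (x - y) * v y) x).symm
  have eright : ∫ y in x..(x + R), stepRecip T (x - y) * v y =
      -∫ s in 0..R, stepRecip T s * v (x + s) := by
    simpa [stepRecip_neg] using (intervalIntegral.integral_comp_add_left (a := 0) (b := R)
      (fun y => stepRecip T (x - y) * v y) x).symm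
  rw [← intervalIntegral.integral_add_adjacent_intervals (hi _ x) (hi x _), eleft, eright,
    ← sub_eq_add_neg, ← intervalIntegral.integral_sub hleft hright]
  simp only [mul_sub]

lemma tendsto_integral_stepRecip_convolution (hT : 0 < T) {v : ℝ → ℝ}
    (hper : Function.Periodic v T) (hv : LocallyIntegrable v) (x : ℝ) :
    Tendsto (fun R => ∫ y in (x - R)..(x + R), stepRecip T (x - y) * v y) atTop (𝓝 0) := by
  have hvi := intervalIntegrable_of_locallyIntegrable hv
  have hminus : ∀ a b, IntervalIntegrable (fun s => v (x - s)) volume a b := fun a b => by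
    simpa using (hvi (x - a) (x - b)).comp_sub_left x
  have hplus : ∀ a b, IntervalIntegrable (fun s => v (x + s)) volume a b := fun a b => by
    simpa using (hvi (x + a) (x + b)).comp_add_left x
  have hw_per : Function.Periodic (fun s => v (x - s) - v (x + s)) T := fun s => by
    simp only [← add_assoc, hper (x + s), ← sub_sub, hper.sub_eq (x - s)]
  have hw : LocallyIntegrable fun s => v (x - s) - v (x + s) :=
    locallyIntegrable_of_periodic (a := 0) hT hw_per
      ((intervalIntegrable_iff_integrableOn_Ioc_of_le (by linarith)).1
        ((hminus _ _).sub (hplus _ _)))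
  have hmean : ∫ s in 0..T, (v (x - s) - v (x + s)) = 0 := by
    rw [intervalIntegral.integral_sub (hminus _ _) (hplus _ _),
      intervalIntegral.integral_comp_sub_left v x, intervalIntegral.integral_comp_add_left v x,
      sub_zero, add_zero, sub_eq_zero]
    simpa using hper.intervalIntegral_add_eq (x - T) x
  simpa only [integral_stepRecip_convolution hT hv] using
    tendsto_integral_stepRecip_mul hT hw_per hw hmean

end StepRecip

/-! ### Principal values -/

lemma pvSet_subset (x ε R : ℝ) : pvSet x ε R ⊆ Ioo (x - R) (x + R) := fun y hy => by
  have := abs_lt.1 hy.2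
  constructor <;> linarith

lemma measurableSet_pvSet (x ε R : ℝ) : MeasurableSet (pvSet x ε R) := by
  have hm : Measurable fun y : ℝ => |x - y| := by fun_prop
  exact (measurableSet_lt measurable_const hm).inter (measurableSet_lt hm measurable_const)

lemma integrableOn_pvSet {g : ℝ → ℝ} (hg : LocallyIntegrable g) (x ε R : ℝ) :
    IntegrableOn g (pvSet x ε R) :=
  (hg.integrableOn_isCompact isCompact_Icc).mono_set
    ((pvSet_subset x ε R).trans Ioo_subset_Icc_self)

lemma eventually_mem_pvSet {x y : ℝ} (h : y ≠ x) :
    ∀ᶠ p : ℝ × ℝ in 𝓝[>] 0 ×ˢ atTop, y ∈ pvSet x p.1 p.2 := by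
  have hε : ∀ᶠ ε : ℝ in 𝓝[>] 0, ε < |x - y| :=
    eventually_nhdsWithin_of_eventually_nhds
      (eventually_lt_nhds (abs_pos.2 (sub_ne_zero.2 h.symm)))
  exact hε.prod_mk (eventually_gt_atTop |x - y|)

lemma hasPV_of_integrable {g : ℝ → ℝ} (hg : Integrable g) (x : ℝ) : HasPV g x (∫ y, g y) := by
  refine ⟨fun _ _ _ => hg.integrableOn, ?_⟩
  simp_rw [← integral_indicator (measurableSet_pvSet _ _ _)]
  refine tendsto_integral_filter_of_dominated_convergence _
    (Eventually.of_forall fun p => hg.1.indicator (measurableSet_pvSet _ _ _))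
    (Eventually.of_forall fun p => Eventually.of_forall fun y => norm_indicator_le_norm_self _ _)
    hg.norm ?_
  filter_upwards [Measure.ae_ne volume x] with y hy
  refine tendsto_const_nhds.congr' ?_
  filter_upwards [eventually_mem_pvSet hy] with p hp
  rw [indicator_of_mem hp]

lemma HasPV.add {f g : ℝ → ℝ} {x v w : ℝ} (hf : HasPV f x v) (hg : HasPV g x w) :
    HasPV (fun y => f y + g y) x (v + w) := by
  refine ⟨fun ε R hε => (hf.1 ε R hε).add (hg.1 ε R hε), (hf.2.add hg.2).congr' ?_⟩
  have hpos : ∀ᶠ p : ℝ × ℝ in 𝓝[>] 0 ×ˢ atTop, 0 < p.1 :=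
    tendsto_fst.eventually eventually_mem_nhdsWithin
  filter_upwards [hpos] with p hp
  exact (integral_add (hf.1 _ _ hp) (hg.1 _ _ hp)).symm

lemma hasPV_stepRecip_mul {T : ℝ} (hT : 0 < T) {v : ℝ → ℝ} (hper : Function.Periodic v T)
    (hv : LocallyIntegrable v) (x : ℝ) : HasPV (fun y => stepRecip T (x - y) * v y) x 0 := by
  refine ⟨fun ε R _ => integrableOn_pvSet (locallyIntegrable_stepRecip_comp_mul hT hv
    (measurable_const.sub measurable_id)) x ε R, ?_⟩
  refine ((tendsto_integral_stepRecip_convolution hT hper hv x).comp tendsto_snd).congr' ?_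
  have hε : ∀ᶠ ε : ℝ in 𝓝[>] 0, ε < T :=
    eventually_nhdsWithin_of_eventually_nhds (eventually_lt_nhds hT)
  filter_upwards [hε.prod_mk (eventually_gt_atTop 0)] with ⟨ε, R⟩ ⟨hεT, hR⟩
  rw [Function.comp_apply, intervalIntegral.integral_of_le (by linarith),
    integral_Ioc_eq_integral_Ioo]
  refine setIntegral_eq_of_subset_of_forall_sdiff_eq_zero measurableSet_Ioo (pvSet_subset _ _ _)
    fun y hy => ?_
  have hyR : |x - y| < R := abs_lt.2 ⟨by linarith [hy.1.2], by linarith [hy.1.1]⟩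
  have hyε : |x - y| ≤ ε := not_lt.1 fun h => hy.2 ⟨h, hyR⟩
  rw [stepRecip_eq_zero hT (hyε.trans_lt hεT), zero_mul]

/-! ### Integral operators dominated by a convolution -/

/-- A measurable kernel on the plane, invariant under simultaneous translation of both variables by
`T` and dominated by an integrable function `q` of their difference. By Young's inequality it acts
on the `T`-periodic functions in `L^p` over a period, with norm at most `∫ q`. -/
structure IsDominatedKernel (T : ℝ) (H : ℝ → ℝ → ℝ) (q : ℝ → ℝ) : Prop where
  measurable : Measurable (Function.uncurry H)
  periodic : ∀ α β, H (α + T) (β + T) = H α β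
  measurable_bound : Measurable q
  integrable_bound : Integrable q
  le_bound : ∀ α β, |H α β| ≤ q (α - β)

namespace IsDominatedKernel

variable {T a : ℝ} {H : ℝ → ℝ → ℝ} {q u : ℝ → ℝ} {p : ℝ≥0∞}

lemma enorm_le (hH : IsDominatedKernel T H q) (α β : ℝ) : ‖H α β‖ₑ ≤ ‖q (α - β)‖ₑ :=
  enorm_le_iff_norm_le.2 ((hH.le_bound α β).trans (le_abs_self _))

lemma lintegral_enorm_bound (hH : IsDominatedKernel T H q) :
    ∫⁻ s, ‖q s‖ₑ = ENNReal.ofReal (∫ s, q s) := by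
  have hq : ∀ s, 0 ≤ q s := fun s => by simpa using (abs_nonneg _).trans (hH.le_bound s 0)
  rw [lintegral_enorm_of_nonneg hq,
    ofReal_integral_eq_lintegral_ofReal hH.integrable_bound (Eventually.of_forall hq)]

lemma periodic_integral (hH : IsDominatedKernel T H q) (hper : Function.Periodic u T) :
    Function.Periodic (fun α => ∫ β, H α β * u β) T := fun α => by
  dsimp only
  rw [← integral_add_right_eq_self _ T]
  simp only [hH.periodic, hper _]

lemma eLpNorm_integral_le (hH : IsDominatedKernel T H q) (hT : 0 < T) (hp : 1 ≤ p) (hp_top : p ≠ ⊤)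
    (hu : AEStronglyMeasurable u) (hper : Function.Periodic u T) :
    eLpNorm (fun α => ∫ β, H α β * u β) p (volume.restrict (Ioc a (a + T))) ≤
      ENNReal.ofReal (∫ s, q s) * eLpNorm u p (volume.restrict (Ioc a (a + T))) := by
  rw [← hH.lintegral_enorm_bound]
  refine eLpNorm_le_of_enorm_le_convolution hT hp hp_top hH.measurable_bound.enorm hu hper
    fun α => (enorm_integral_le_lintegral_enorm _).trans (lintegral_mono fun β => ?_)
  dsimp only
  rw [enorm_mul]
  gcongr
  exact hH.enorm_le α β

lemma integrableOn_prod (hH : IsDominatedKernel T H q) (hT : 0 < T) (hu : LocallyIntegrable u)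
    (hper : Function.Periodic u T) :
    IntegrableOn (fun x : ℝ × ℝ => H x.1 x.2 * u x.2) (Ioc a (a + T) ×ˢ univ) := by
  refine Integrable.mono (integrableOn_prod_convolution_of_periodic hT hH.measurable_bound
    hH.integrable_bound hper hu) ?_ (Eventually.of_forall fun x => ?_)
  · exact (hH.measurable.aestronglyMeasurable.mul hu.aestronglyMeasurable.comp_snd).restrict
  · rw [norm_mul, norm_mul]
    exact mul_le_mul_of_nonneg_right ((hH.le_bound _ _).trans (le_abs_self _)) (norm_nonneg _)

lemma memLp_integral (hH : IsDominatedKernel T H q) (hT : 0 < T) (hp : 1 ≤ p) (hp_top : p ≠ ⊤)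
    (hu : MemLp u p (volume.restrict (Ioc a (a + T)))) (hper : Function.Periodic u T) :
    MemLp (fun α => ∫ β, H α β * u β) p (volume.restrict (Ioc a (a + T))) := by
  have hloc : LocallyIntegrable u := locallyIntegrable_of_periodic hT hper (hu.integrable hp)
  have hprod := hH.integrableOn_prod (a := a) hT hloc hper
  rw [IntegrableOn, Measure.volume_eq_prod, ← Measure.prod_restrict, Measure.restrict_univ] at hprod
  exact ⟨hprod.integral_prod_left.aestronglyMeasurable,
    (hH.eLpNorm_integral_le hT hp hp_top hloc.aestronglyMeasurable hper).trans_lt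
      (ENNReal.mul_lt_top ENNReal.ofReal_lt_top hu.2)⟩

lemma integrable_left (hH : IsDominatedKernel T H q) (hT : 0 < T) {φ : ℝ → ℝ} (hφ : Continuous φ)
    (hφT : Function.Periodic φ T) (β : ℝ) : Integrable fun α => H α β * φ α := by
  obtain ⟨B, hB⟩ := (hφT.isBounded_of_continuous hT.ne' hφ).exists_norm_le
  refine ((hH.integrable_bound.comp_sub_right β).mono'
    (hH.measurable.comp (measurable_id.prodMk measurable_const)).aestronglyMeasurable
    (Eventually.of_forall fun α => hH.le_bound α β)).mul_bdd (c := B) hφ.aestronglyMeasurable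
    (Eventually.of_forall fun α => hB _ (mem_range_self α))

lemma integral_integral_mul_eq (hH : IsDominatedKernel T H q) (hT : 0 < T)
    (hu : LocallyIntegrable u) (hper : Function.Periodic u T) {φ : ℝ → ℝ} (hφ : Continuous φ)
    (hφT : Function.Periodic φ T) :
    ∫ α in Ioc a (a + T), (∫ β, H α β * u β) * φ α =
      ∫ β in Ioc a (a + T), u β * ∫ α, H α β * φ α := by
  obtain ⟨B, hB⟩ := (hφT.isBounded_of_continuous hT.ne' hφ).exists_norm_le
  have hint : IntegrableOn (fun x : ℝ × ℝ => H x.1 x.2 * u x.2 * φ x.1)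
      (Ioc a (a + T) ×ˢ univ) :=
    (hH.integrableOn_prod hT hu hper).mul_bdd (c := B)
      (hφ.comp continuous_fst).aestronglyMeasurable
      (Eventually.of_forall fun x => hB _ (mem_range_self x.1))
  have hperiodic : Function.Periodic (fun x : ℝ × ℝ => H x.1 x.2 * u x.2 * φ x.1) (T, T) :=
    fun x => by simp only [Prod.fst_add, Prod.snd_add, hH.periodic, hper _, hφT _]
  calc ∫ α in Ioc a (a + T), (∫ β, H α β * u β) * φ α
      = ∫ α in Ioc a (a + T), ∫ β, H α β * u β * φ α := by simp only [integral_mul_const]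
    _ = ∫ β in Ioc a (a + T), ∫ α, H α β * u β * φ α :=
        integral_integral_swap_of_periodic hT hperiodic hint
    _ = ∫ β in Ioc a (a + T), u β * ∫ α, H α β * φ α := by
        simp only [mul_comm (H _ _) (u _), mul_assoc, integral_const_mul]

end IsDominatedKernel

/-! ### Smoothing kernels -/

/-- A translation invariant kernel `K` that equals `b(β) / (α - β)` at infinity, up to a remainder
with integrable tail; `1 / (α - β)` is replaced by `stepRecip`, which is bounded. The derivative
`K'` of `K` in the first variable is dominated by the integrable function `k`, and the singularities
of `K` on the diagonal are removable. The operator `u ↦ PV ∫ K(·, β) u(β) dβ` then gains one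
derivative. -/
structure IsSmoothingKernel (T : ℝ) (K K' : ℝ → ℝ → ℝ) (b : ℝ → ℝ) (A R : ℝ) (k : ℝ → ℝ) :
    Prop where
  measurable_kernel : Measurable (Function.uncurry K)
  periodic_kernel : ∀ α β, K (α + T) (β + T) = K α β
  continuous_coeff : Continuous b
  periodic_coeff : Function.Periodic b T
  radius_ne_zero : R ≠ 0
  remainder_le : ∀ α β, |K α β - b β * stepRecip T (α - β)| ≤ A * cauchyWeight R (α - β)
  dominated_deriv : IsDominatedKernel T K' k
  hasDerivAt : ∀ α β, α ≠ β → HasDerivAt (fun a => K a β) (K' α β) α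
  exists_limit : ∀ β, ∃ l, Tendsto (fun a => K a β) (𝓝[≠] β) (𝓝 l)

lemma tendsto_cauchyWeight_cobounded {R : ℝ} (hR : R ≠ 0) :
    Tendsto (cauchyWeight R) (Bornology.cobounded ℝ) (𝓝 0) := by
  have hsq : Tendsto (fun s : ℝ => R ^ 2 * s⁻¹ ^ 2) (Bornology.cobounded ℝ) (𝓝 0) := by
    simpa using ((tendsto_inv₀_cobounded (α := ℝ)).pow 2).const_mul (R ^ 2)
  refine squeeze_zero' (Eventually.of_forall fun s => (cauchyWeight_pos R s).le) ?_ hsq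
  filter_upwards [Bornology.eventually_ne_cobounded 0] with s hs
  rw [← mul_pow, ← div_eq_mul_inv, ← inv_div, inv_pow, cauchyWeight]
  gcongr
  linarith

lemma integral_eq_sub_of_hasDerivAt_of_tendsto_nhdsNE {E : Type*} [NormedAddCommGroup E]
    [NormedSpace ℝ E] [CompleteSpace E] {f f' : ℝ → E} {a b c : ℝ} {l : E} (ha : a ≠ c)
    (hb : b ≠ c) (hderiv : ∀ x, x ≠ c → HasDerivAt f (f' x) x) (hlim : Tendsto f (𝓝[≠] c) (𝓝 l))
    (hint : IntervalIntegrable f' volume a b) : ∫ x in a..b, f' x = f b - f a := by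
  have hev : ∀ x, x ≠ c → Function.update f c l =ᶠ[𝓝 x] f := fun x hx => by
    filter_upwards [isOpen_ne.mem_nhds hx] with y hy using Function.update_of_ne hy _ _
  have hcont : Continuous (Function.update f c l) := continuous_iff_continuousAt.2 fun x => by
    rcases eq_or_ne x c with rfl | hx
    · exact continuousAt_update_same.2 hlim
    · exact (hderiv x hx).continuousAt.congr (hev x hx).symm
  rw [integral_eq_of_hasDerivAt_off_countable (Function.update f c l) f' (countable_singleton c)
    hcont.continuousOn (fun x hx => (hderiv x hx.2).congr_of_eventuallyEq (hev x hx.2)) hint,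
    Function.update_of_ne hb, Function.update_of_ne ha]

lemma periodic_deriv {E : Type*} [NormedAddCommGroup E] [NormedSpace ℝ E] {f : ℝ → E} {T : ℝ}
    (hf : Function.Periodic f T) : Function.Periodic (deriv f) T := fun x => by
  rw [← deriv_comp_add_const, hf.funext]

namespace IsSmoothingKernel

variable {T A R a : ℝ} {K K' : ℝ → ℝ → ℝ} {b k u : ℝ → ℝ}

lemma dominated_remainder (hK : IsSmoothingKernel T K K' b A R k) :
    IsDominatedKernel T (fun α β => K α β - b β * stepRecip T (α - β))
      fun s => A * cauchyWeight R s where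
  measurable := hK.measurable_kernel.sub ((hK.continuous_coeff.measurable.comp measurable_snd).mul
    ((measurable_stepRecip T).comp (measurable_fst.sub measurable_snd)))
  periodic α β := by
    simp only [hK.periodic_kernel, hK.periodic_coeff β, add_sub_add_right_eq_sub]
  measurable_bound := (measurable_cauchyWeight R).const_mul A
  integrable_bound := (integrable_cauchyWeight hK.radius_ne_zero).const_mul A
  le_bound := hK.remainder_le

lemma integrable_remainder (hK : IsSmoothingKernel T K K' b A R k) (hT : 0 < T)
    (hu : LocallyIntegrable u) (hper : Function.Periodic u T) (α : ℝ) :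
    Integrable fun β => (K α β - b β * stepRecip T (α - β)) * u β := by
  refine ((integrable_cauchyWeight_mul_of_periodic hT hK.radius_ne_zero hper hu
    α).norm.const_mul A).mono' ?_ (Eventually.of_forall fun β => ?_)
  · exact (hK.dominated_remainder.measurable.comp
      (measurable_const.prodMk measurable_id)).aestronglyMeasurable.mul hu.aestronglyMeasurable
  · rw [norm_mul, norm_mul, ← mul_assoc, Real.norm_of_nonneg (cauchyWeight_pos R _).le]
    exact mul_le_mul_of_nonneg_right (hK.remainder_le α β) (norm_nonneg _)

lemma hasPV (hK : IsSmoothingKernel T K K' b A R k) (hT : 0 < T) (hu : LocallyIntegrable u)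
    (hper : Function.Periodic u T) (α : ℝ) :
    HasPV (fun β => K α β * u β) α (∫ β, (K α β - b β * stepRecip T (α - β)) * u β) := by
  have hsum := (hasPV_of_integrable (hK.integrable_remainder hT hu hper α) α).add
    (hasPV_stepRecip_mul hT (hK.periodic_coeff.mul hper)
      (hu.continuous_smul hK.continuous_coeff) α)
  rw [add_zero] at hsum
  convert hsum using 2
  simp only [Pi.mul_apply]
  ring

lemma pv_eq (hK : IsSmoothingKernel T K K' b A R k) (hT : 0 < T) (hu : LocallyIntegrable u)
    (hper : Function.Periodic u T) (α : ℝ) :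
    pv (fun β => K α β * u β) α = ∫ β, (K α β - b β * stepRecip T (α - β)) * u β :=
  (hK.hasPV hT hu hper α).2.limUnder_eq

lemma tendsto_cobounded (hK : IsSmoothingKernel T K K' b A R k) (hT : 0 < T) (β : ℝ) :
    Tendsto (fun α => K α β) (Bornology.cobounded ℝ) (𝓝 0) := by
  have hrem : Tendsto (fun s => A * cauchyWeight R s) (Bornology.cobounded ℝ) (𝓝 0) := by
    simpa using (tendsto_cauchyWeight_cobounded hK.radius_ne_zero).const_mul A
  have hdiff : Tendsto (fun α => K α β - b β * stepRecip T (α - β)) (Bornology.cobounded ℝ)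
      (𝓝 0) :=
    squeeze_zero_norm (fun α => hK.remainder_le α β) (hrem.comp (tendsto_sub_const_cobounded β))
  simpa using hdiff.add
    (((tendsto_stepRecip_cobounded hT).comp (tendsto_sub_const_cobounded β)).const_mul (b β))

lemma integral_deriv_mul_add_remainder_mul_deriv (hK : IsSmoothingKernel T K K' b A R k)
    (hT : 0 < T) {φ : ℝ → ℝ} (hφ : ContDiff ℝ 1 φ) (hφT : Function.Periodic φ T) (β : ℝ) {r : ℝ}
    (hr : 0 < r) :
    ∫ α in (β - r)..(β + r), K' α β * φ α + (K α β - b β * stepRecip T (α - β)) * deriv φ α =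
      K (β + r) β * φ (β + r) - K (β - r) β * φ (β - r) +
        b β * ∫ α in (β - r)..(β + r), stepRecip T (β - α) * deriv φ α := by
  have hφ' : Continuous (deriv φ) := hφ.continuous_deriv le_rfl
  have hrem : IntervalIntegrable (fun α =>
      K' α β * φ α + (K α β - b β * stepRecip T (α - β)) * deriv φ α) volume (β - r) (β + r) :=
    ((hK.dominated_deriv.integrable_left hT hφ.continuous hφT β).add
      (hK.dominated_remainder.integrable_left hT hφ' (periodic_deriv hφT) β)).intervalIntegrable
  have hstep := (intervalIntegrable_of_locallyIntegrable (locallyIntegrable_stepRecip_comp_mul hT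
    hφ'.locallyIntegrable (measurable_const_sub β)) (β - r) (β + r)).const_mul (b β)
  obtain ⟨l, hl⟩ := hK.exists_limit β
  have hparts := integral_eq_sub_of_hasDerivAt_of_tendsto_nhdsNE (f := fun α => K α β * φ α)
    (f' := fun α => K' α β * φ α + (K α β - b β * stepRecip T (α - β)) * deriv φ α
      - b β * (stepRecip T (β - α) * deriv φ α))
    (a := β - r) (b := β + r) (by linarith) (by linarith) (fun α hα => by
      refine ((hK.hasDerivAt α β hα).mul (hφ.differentiable_one α).hasDerivAt).congr_deriv ?_
      rw [← neg_sub α β, stepRecip_neg]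
      ring)
    (hl.mul (hφ.continuous.continuousAt.mono_left nhdsWithin_le_nhds)) (hrem.sub hstep)
  rw [intervalIntegral.integral_sub hrem hstep, intervalIntegral.integral_const_mul] at hparts
  linarith

/-- Integrate by parts over `[β - r, β + r]` and let `r → ∞`. The boundary terms vanish, and so does
the contribution of `b(β) / (α - β)`, which is not absolutely integrable at infinity. -/
lemma integral_remainder_mul_deriv (hK : IsSmoothingKernel T K K' b A R k) (hT : 0 < T) {φ : ℝ → ℝ}
    (hφ : ContDiff ℝ 1 φ) (hφT : Function.Periodic φ T) (β : ℝ) :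
    ∫ α, (K α β - b β * stepRecip T (α - β)) * deriv φ α = -∫ α, K' α β * φ α := by
  have hφ' : Continuous (deriv φ) := hφ.continuous_deriv le_rfl
  have hφ'T : Function.Periodic (deriv φ) T := periodic_deriv hφT
  have hi := hK.dominated_deriv.integrable_left hT hφ.continuous hφT β
  have hj := hK.dominated_remainder.integrable_left hT hφ' hφ'T β
  have hlo : Tendsto (fun r : ℝ => β - r) atTop atBot :=
    tendsto_atBot_add_const_left atTop β tendsto_neg_atTop_atBot
  have hhi : Tendsto (fun r : ℝ => β + r) atTop atTop :=
    tendsto_atTop_add_const_left atTop β tendsto_id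
  have hboundary : Tendsto (fun α => K α β * φ α) (Bornology.cobounded ℝ) (𝓝 0) := by
    obtain ⟨B, hB⟩ := (hφT.isBounded_of_continuous hT.ne' hφ.continuous).exists_norm_le
    exact (hK.tendsto_cobounded hT β).zero_mul_isBoundedUnder_le
      (isBoundedUnder_of ⟨B, fun α => hB _ (mem_range_self α)⟩)
  have hlim : Tendsto (fun r => ∫ α in (β - r)..(β + r),
      K' α β * φ α + (K α β - b β * stepRecip T (α - β)) * deriv φ α) atTop (𝓝 0) := by
    have h := ((hboundary.comp (hhi.mono_right IsOrderBornology.atTop_le_cobounded)).sub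
      (hboundary.comp (hlo.mono_right IsOrderBornology.atBot_le_cobounded))).add
      ((tendsto_integral_stepRecip_convolution hT hφ'T hφ'.locallyIntegrable β).const_mul (b β))
    rw [sub_zero, mul_zero, add_zero] at h
    refine h.congr' ?_
    filter_upwards [eventually_gt_atTop 0] with r hr
    exact (hK.integral_deriv_mul_add_remainder_mul_deriv hT hφ hφT β hr).symm
  have hzero := tendsto_nhds_unique (intervalIntegral_tendsto_integral (hi.add hj) hlo hhi) hlim
  rw [integral_add' hi hj] at hzero
  linarith

lemma setIntegral_pv_mul_deriv (hK : IsSmoothingKernel T K K' b A R k) (hT : 0 < T)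
    (hu : LocallyIntegrable u) (hper : Function.Periodic u T) {φ : ℝ → ℝ} (hφ : ContDiff ℝ 1 φ)
    (hφT : Function.Periodic φ T) :
    ∫ α in Ioc a (a + T), pv (fun β => K α β * u β) α * deriv φ α =
      -∫ α in Ioc a (a + T), (∫ β, K' α β * u β) * φ α := by
  simp only [hK.pv_eq hT hu hper]
  rw [hK.dominated_remainder.integral_integral_mul_eq hT hu hper (hφ.continuous_deriv le_rfl)
    (periodic_deriv hφT),
    hK.dominated_deriv.integral_integral_mul_eq hT hu hper hφ.continuous hφT]
  simp only [hK.integral_remainder_mul_deriv hT hφ hφT, mul_neg, integral_neg]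

end IsSmoothingKernel

/-! ### Taylor estimates -/

section Taylor

variable {E : Type*} [NormedAddCommGroup E] [NormedSpace ℝ E] {f f' f'' : ℝ → E} {C M δ : ℝ}

lemma norm_sub_sub_smul_le {α β : ℝ} (hf : ∀ x, HasDerivAt f (f' x) x)
    (hC : ∀ x ∈ uIcc β α, ‖f' x - f' β‖ ≤ C) :
    ‖f α - f β - (α - β) • f' β‖ ≤ C * |α - β| := by
  have hderiv : ∀ x, HasDerivAt (fun x => f x - (x - β) • f' β) (f' x - f' β) x := fun x => by
    simpa only [one_smul] using (hf x).fun_sub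
      (((hasDerivAt_id' x).sub_const β).smul_const (f' β))
  have hmean := (convex_uIcc β α).norm_image_sub_le_of_norm_hasDerivWithin_le
    (fun x _ => (hderiv x).hasDerivWithinAt) hC left_mem_uIcc right_mem_uIcc
  simpa only [sub_self, zero_smul, sub_zero, sub_right_comm, Real.norm_eq_abs] using hmean

lemma norm_sub_sub_smul_le_of_holder (hf : ∀ x, HasDerivAt f (f' x) x) (hM : 0 ≤ M) (hδ : 0 ≤ δ)
    (hholder : ∀ x y, ‖f' x - f' y‖ ≤ M * |x - y| ^ δ) (α β : ℝ) :
    ‖f α - f β - (α - β) • f' β‖ ≤ M * |α - β| ^ δ * |α - β| :=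
  norm_sub_sub_smul_le hf fun x hx => (hholder x β).trans <| by
    have := abs_sub_left_of_mem_uIcc hx
    gcongr

lemma norm_sub_sub_smul_sub_smul_le_of_holder (hf : ∀ x, HasDerivAt f (f' x) x)
    (hf' : ∀ x, HasDerivAt f' (f'' x) x) (hM : 0 ≤ M) (hδ : 0 ≤ δ)
    (hholder : ∀ x y, ‖f'' x - f'' y‖ ≤ M * |x - y| ^ δ) (α β : ℝ) :
    ‖f α - f β - (α - β) • f' β - ((α - β) ^ 2 / 2) • f'' β‖ ≤
      M * |α - β| ^ δ * |α - β| ^ 2 := by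
  have hquad : ∀ x, HasDerivAt (fun x : ℝ => (x - β) ^ 2 / 2) (x - β) x := fun x =>
    ((((hasDerivAt_id x).sub_const β).pow 2).div_const 2).congr_deriv (by simp)
  have hbound : ∀ x ∈ uIcc β α, ‖(f' x - (x - β) • f'' β) - (f' β - (β - β) • f'' β)‖ ≤
      M * |α - β| ^ δ * |α - β| := fun x hx => by
    have hdist := abs_sub_left_of_mem_uIcc hx
    have htaylor := norm_sub_sub_smul_le_of_holder hf' hM hδ hholder x β
    rw [sub_self, zero_smul, sub_zero, sub_right_comm]
    exact htaylor.trans (by gcongr)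
  have htaylor := norm_sub_sub_smul_le (f := fun x => f x - ((x - β) ^ 2 / 2) • f'' β)
    (fun x => (hf x).sub ((hquad x).smul_const (f'' β))) hbound
  convert htaylor using 1
  · congr 1
    simp only [sub_self, zero_smul, sub_zero, ne_eq, OfNat.ofNat_ne_zero, not_false_eq_true,
      zero_pow, zero_div]
    abel
  · ring

end Taylor

/-! ### Periodic curves -/

/-- A periodic `C¹` curve whose derivative and whose deviation from the horizontal axis are
controlled by a single constant `M`. -/
structure CurveBound (M : ℝ) (z : ℝ → ℂ) : Prop where
  contDiff : ContDiff ℝ 1 z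
  periodic : IsPeriodicCurve z
  pi_le : π ≤ M
  deviation : ∀ α : ℝ, ‖z α - α‖ ≤ 2 * M
  norm_deriv : ∀ α, ‖deriv z α‖ ≤ M

/-- A `CurveBound` of class `C^{2,δ}`, with the same constant `M` for the second derivative and its
Hölder seminorm. -/
structure HolderCurveBound (δ M : ℝ) (z : ℝ → ℂ) : Prop extends CurveBound M z where
  contDiff_deriv : ContDiff ℝ 1 (deriv z)
  norm_deriv_deriv : ∀ α, ‖deriv (deriv z) α‖ ≤ M
  holder : ∀ α β, ‖deriv (deriv z) α - deriv (deriv z) β‖ ≤ M * |α - β| ^ δ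

/-- The arc-chord condition `‖F(z)‖_{L^∞} ≤ F`, with the value of `F(z)` on the diagonal entering
only through its finiteness. -/
structure ChordBound (F : ℝ) (z : ℝ → ℂ) : Prop where
  one_le : 1 ≤ F
  chord : ∀ α β, (α - β) ^ 2 ≤ F * ‖z α - z β‖ ^ 2
  deriv_ne_zero : ∀ α, deriv z α ≠ 0

/-- Two curves at distance at least `D^{-1/2}` from each other, where `D ≥ 1`. -/
structure IsSeparated (D : ℝ) (x y : ℝ → ℂ) : Prop where
  one_le : 1 ≤ D
  one_le_mul : ∀ α β, 1 ≤ D * ‖x α - y β‖ ^ 2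

lemma le_mul_of_sq_le_mul_sq {c s t : ℝ} (hc : 1 ≤ c) (ht : 0 ≤ t) (h : s ^ 2 ≤ c * t ^ 2) :
    s ≤ c * t := by
  refine le_of_sq_le_sq (h.trans ?_) (by positivity)
  rw [mul_pow]
  gcongr
  exact le_self_pow₀ hc two_ne_zero

namespace IsPeriodicCurve

variable {z : ℝ → ℂ}

lemma periodic_sub (hz : IsPeriodicCurve z) :
    Function.Periodic (fun α : ℝ => z α - α) (2 * π) := fun α => by
  dsimp only
  rw [hz α]
  push_cast
  ring

lemma periodic_deriv (hz : IsPeriodicCurve z) : Function.Periodic (deriv z) (2 * π) := fun α => by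
  rw [← deriv_comp_add_const, funext hz, deriv_add_const]

lemma add_sub_add (hz : IsPeriodicCurve z) {y : ℝ → ℂ} (hy : IsPeriodicCurve y) (α β : ℝ) :
    z (α + 2 * π) - y (β + 2 * π) = z α - y β := by
  rw [hz, hy, add_sub_add_right_eq_sub]

end IsPeriodicCurve

section HolderNorm

variable {δ : ℝ} {z : ℝ → ℂ}

lemma norm_le_toReal_of_enorm_le {E : Type*} [SeminormedAddGroup E] {x : E} {a : ℝ≥0∞}
    (ha : a ≠ ⊤) (h : ‖x‖ₑ ≤ a) : ‖x‖ ≤ a.toReal := by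
  rw [← toReal_enorm]
  exact ENNReal.toReal_mono ha h

lemma norm_le_holderNorm (h : holderNorm δ z ≠ ⊤) {α : ℝ} (hα : α ∈ Icc (-π) π) :
    ‖z α‖ ≤ (holderNorm δ z).toReal := by
  refine norm_le_toReal_of_enorm_le h
    ((le_iSup₂ (f := fun (α : ℝ) (_ : α ∈ Icc (-π) π) => ‖z α‖ₑ) α hα).trans ?_)
  rw [holderNorm, add_assoc, add_assoc]
  exact le_self_add

lemma norm_deriv_le_holderNorm (h : holderNorm δ z ≠ ⊤) (α : ℝ) :
    ‖deriv z α‖ ≤ (holderNorm δ z).toReal := by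
  refine norm_le_toReal_of_enorm_le h ((le_iSup (fun α => ‖deriv z α‖ₑ) α).trans ?_)
  rw [holderNorm, add_assoc, add_assoc]
  exact le_self_add.trans le_add_self

lemma norm_deriv_deriv_le_holderNorm (h : holderNorm δ z ≠ ⊤) (α : ℝ) :
    ‖deriv (deriv z) α‖ ≤ (holderNorm δ z).toReal := by
  refine norm_le_toReal_of_enorm_le h ((le_iSup (fun α => ‖deriv (deriv z) α‖ₑ) α).trans ?_)
  rw [holderNorm, add_assoc]
  exact le_self_add.trans le_add_self

lemma norm_deriv_deriv_sub_le_holderNorm (h : holderNorm δ z ≠ ⊤) (hδ : 0 ≤ δ) (α β : ℝ) :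
    ‖deriv (deriv z) α - deriv (deriv z) β‖ ≤ (holderNorm δ z).toReal * |α - β| ^ δ := by
  rcases eq_or_ne α β with rfl | hαβ
  · rw [sub_self, norm_zero]
    positivity
  have hle : ‖deriv (deriv z) α - deriv (deriv z) β‖ₑ / ‖α - β‖ₑ ^ δ ≤ holderNorm δ z :=
    (le_iSup₂ (f := fun α β : ℝ =>
      ‖deriv (deriv z) α - deriv (deriv z) β‖ₑ / ‖α - β‖ₑ ^ δ) α β).trans le_add_self
  have hne : ‖α - β‖ₑ ≠ 0 := enorm_ne_zero.2 (sub_ne_zero.2 hαβ)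
  rw [ENNReal.div_le_iff (by simp [hne]) (by simp [hδ])] at hle
  have hreal := norm_le_toReal_of_enorm_le (ENNReal.mul_ne_top h (by simp [hδ])) hle
  rwa [ENNReal.toReal_mul, ← ENNReal.toReal_rpow, toReal_enorm, Real.norm_eq_abs] at hreal

lemma IsPeriodicCurve.pi_le_holderNorm (hz : IsPeriodicCurve z) (h : holderNorm δ z ≠ ⊤) :
    π ≤ (holderNorm δ z).toReal := by
  have hpi := Real.pi_pos
  have hright := norm_le_holderNorm h ⟨by linarith, le_refl π⟩
  have hleft := norm_le_holderNorm h ⟨le_refl (-π), by linarith⟩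
  have hperiod := hz (-π)
  rw [show -π + 2 * π = π by ring] at hperiod
  have hdiff : ‖((2 * π : ℝ) : ℂ)‖ ≤ ‖z π‖ + ‖z (-π)‖ := by
    rw [← sub_eq_iff_eq_add'.2 hperiod]
    exact norm_sub_le _ _
  rw [Complex.norm_real, Real.norm_of_nonneg (by positivity)] at hdiff
  linarith

lemma IsPeriodicCurve.one_le_holderNorm (hz : IsPeriodicCurve z) : 1 ≤ holderNorm δ z := by
  rcases eq_or_ne (holderNorm δ z) ⊤ with h | h
  · exact h ▸ le_top
  · rw [← ENNReal.toReal_le_toReal ENNReal.one_ne_top h, ENNReal.toReal_one]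
    linarith [hz.pi_le_holderNorm h, Real.pi_gt_three]

lemma IsPeriodicCurve.norm_sub_le_holderNorm (hz : IsPeriodicCurve z) (h : holderNorm δ z ≠ ⊤)
    (α : ℝ) : ‖z α - α‖ ≤ 2 * (holderNorm δ z).toReal := by
  obtain ⟨β, hβ, hαβ⟩ := hz.periodic_sub.exists_mem_Ioc Real.two_pi_pos α (-π)
  rw [show -π + 2 * π = π by ring] at hβ
  have hβ_norm : ‖(β : ℂ)‖ ≤ π := by
    rw [Complex.norm_real]
    exact abs_le.2 ⟨hβ.1.le, hβ.2⟩
  rw [hαβ]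
  linarith [norm_sub_le (z β) β, norm_le_holderNorm h ⟨hβ.1.le, hβ.2⟩, hz.pi_le_holderNorm h]

lemma IsC2Holder.holderCurveBound (h : IsC2Holder δ z) (hz : IsPeriodicCurve z) (hδ : 0 ≤ δ) :
    HolderCurveBound δ (holderNorm δ z).toReal z where
  contDiff := h.1.of_le one_le_two
  periodic := hz
  pi_le := hz.pi_le_holderNorm h.2.ne
  deviation := hz.norm_sub_le_holderNorm h.2.ne
  norm_deriv := norm_deriv_le_holderNorm h.2.ne
  contDiff_deriv := ((contDiff_succ_iff_deriv (n := 1)).1 h.1).2.2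
  norm_deriv_deriv := norm_deriv_deriv_le_holderNorm h.2.ne
  holder := norm_deriv_deriv_sub_le_holderNorm h.2.ne hδ

end HolderNorm

section ArcChord

variable {z y : ℝ → ℂ}

lemma sq_le_arcChordNorm_mul (h : arcChordNorm z ≠ ⊤) (α β : ℝ) :
    (α - β) ^ 2 ≤ (arcChordNorm z).toReal * ‖z α - z β‖ ^ 2 := by
  rcases eq_or_ne α β with rfl | hαβ
  · simp
  have hne : α - β ≠ 0 := sub_ne_zero.2 hαβ
  have hle : arcChord z α (α - β) ≤ arcChordNorm z :=
    le_iSup₂ (f := fun α β => arcChord z α β) α (α - β)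
  rw [arcChord, if_neg hne, sub_sub_cancel] at hle
  have hchord : ‖z α - z β‖ₑ ≠ 0 := fun h0 => h <| by
    rwa [h0, zero_pow two_ne_zero, ENNReal.div_zero (by simpa using hne), top_le_iff] at hle
  rw [ENNReal.div_le_iff (by simpa using hchord) (by simp)] at hle
  simpa using ENNReal.toReal_mono (ENNReal.mul_ne_top h (by simp)) hle

lemma deriv_ne_zero_of_arcChordNorm_ne_top (h : arcChordNorm z ≠ ⊤) (α : ℝ) : deriv z α ≠ 0 := by
  intro h0
  have hle : arcChord z α 0 ≤ arcChordNorm z := le_iSup₂ (f := fun α β => arcChord z α β) α 0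
  rw [arcChord, if_pos rfl, h0] at hle
  simp [h] at hle

lemma IsPeriodicCurve.one_le_arcChordNorm (hz : IsPeriodicCurve z) : 1 ≤ arcChordNorm z := by
  have hle : arcChord z (0 + 2 * π) (2 * π) ≤ arcChordNorm z :=
    le_iSup₂ (f := fun α β => arcChord z α β) (0 + 2 * π) (2 * π)
  have hpi : ‖2 * π‖ₑ ≠ 0 := by simp
  rwa [arcChord, if_neg Real.two_pi_pos.ne', add_sub_cancel_right, hz, add_sub_cancel_left,
    ← ofReal_norm ((2 * π : ℝ) : ℂ), Complex.norm_real, ofReal_norm,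
    ENNReal.div_self (pow_ne_zero 2 hpi) (ENNReal.pow_ne_top enorm_ne_top)] at hle

lemma IsPeriodicCurve.chordBound (hz : IsPeriodicCurve z) (h : arcChordNorm z ≠ ⊤) :
    ChordBound (arcChordNorm z).toReal z where
  one_le := by simpa using ENNReal.toReal_mono h hz.one_le_arcChordNorm
  chord := sq_le_arcChordNorm_mul h
  deriv_ne_zero := deriv_ne_zero_of_arcChordNorm_ne_top h

lemma isSeparated_distNorm (h : distNorm z y ≠ ⊤) :
    IsSeparated (max 1 (distNorm z y)).toReal z y := by
  have htop : max 1 (distNorm z y) ≠ ⊤ := max_ne_top ENNReal.one_ne_top h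
  refine ⟨by simpa using ENNReal.toReal_mono htop (le_max_left 1 _), fun α β => ?_⟩
  have hle : 1 / ‖z α - y β‖ₑ ^ 2 ≤ max 1 (distNorm z y) :=
    (le_iSup₂ (f := fun α β => 1 / ‖z α - y β‖ₑ ^ 2) α β).trans (le_max_right _ _)
  have hne : ‖z α - y β‖ₑ ≠ 0 := fun h0 => htop <| by
    rwa [h0, zero_pow two_ne_zero, ENNReal.div_zero one_ne_zero, top_le_iff] at hle
  rw [ENNReal.div_le_iff (by simpa using hne) (by simp)] at hle
  simpa using ENNReal.toReal_mono (ENNReal.mul_ne_top htop (by simp)) hle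

end ArcChord

namespace CurveBound

variable {M N : ℝ} {x y z : ℝ → ℂ}

lemma hasDerivAt (hz : CurveBound M z) (α : ℝ) : HasDerivAt z (deriv z α) α :=
  (hz.contDiff.differentiable_one α).hasDerivAt

lemma continuous (hz : CurveBound M z) : Continuous z := hz.contDiff.continuous

lemma continuous_deriv (hz : CurveBound M z) : Continuous (deriv z) :=
  hz.contDiff.continuous_deriv_one

lemma one_le (hz : CurveBound M z) : 1 ≤ M := by linarith [hz.pi_le, Real.pi_gt_three]

lemma nonneg (hz : CurveBound M z) : 0 ≤ M := zero_le_one.trans hz.one_le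

lemma norm_sub_le (hz : CurveBound M z) (α β : ℝ) : ‖z α - z β‖ ≤ M * |α - β| :=
  convex_univ.norm_image_sub_le_of_norm_hasDerivWithin_le
    (fun x _ => (hz.hasDerivAt x).hasDerivWithinAt) (fun x _ => hz.norm_deriv x)
    (mem_univ β) (mem_univ α)

lemma norm_sub_sub_ofReal_le (hx : CurveBound M x) (hy : CurveBound N y) (α β : ℝ) :
    ‖x α - y β - (α - β : ℝ)‖ ≤ 2 * (M + N) := by
  have hsplit : x α - y β - (α - β : ℝ) = (x α - α) - (y β - β) := by push_cast; ring
  rw [hsplit]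
  linarith [_root_.norm_sub_le (x α - α) (y β - β), hx.deviation α, hy.deviation β]

end CurveBound

namespace HolderCurveBound

variable {δ M : ℝ} {z : ℝ → ℂ}

lemma hasDerivAt_deriv (hz : HolderCurveBound δ M z) (α : ℝ) :
    HasDerivAt (deriv z) (deriv (deriv z) α) α :=
  (hz.contDiff_deriv.differentiable_one α).hasDerivAt

lemma norm_deriv_sub_le (hz : HolderCurveBound δ M z) (α β : ℝ) :
    ‖deriv z α - deriv z β‖ ≤ M * |α - β| :=
  convex_univ.norm_image_sub_le_of_norm_hasDerivWithin_le
    (fun x _ => (hz.hasDerivAt_deriv x).hasDerivWithinAt) (fun x _ => hz.norm_deriv_deriv x)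
    (mem_univ β) (mem_univ α)

lemma norm_sub_sub_mul_deriv_le (hz : HolderCurveBound δ M z) (α β : ℝ) :
    ‖z α - z β - (α - β : ℝ) * deriv z β‖ ≤ M * |α - β| ^ 2 := by
  have := norm_sub_sub_smul_le_of_holder hz.hasDerivAt hz.nonneg zero_le_one
    (by simpa only [Real.rpow_one] using hz.norm_deriv_sub_le) α β
  rwa [Complex.real_smul, Real.rpow_one, mul_assoc, ← sq] at this

lemma norm_deriv_sub_sub_mul_le (hz : HolderCurveBound δ M z) (hδ : 0 ≤ δ) (α β : ℝ) :
    ‖deriv z α - deriv z β - (α - β : ℝ) * deriv (deriv z) β‖ ≤ M * |α - β| ^ δ * |α - β| := by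
  have := norm_sub_sub_smul_le_of_holder hz.hasDerivAt_deriv hz.nonneg hδ hz.holder α β
  rwa [Complex.real_smul] at this

lemma norm_sub_sub_mul_sub_mul_le (hz : HolderCurveBound δ M z) (hδ : 0 ≤ δ) (α β : ℝ) :
    ‖z α - z β - (α - β : ℝ) * deriv z β - ((α - β : ℝ) : ℂ) ^ 2 / 2 * deriv (deriv z) β‖ ≤
      M * |α - β| ^ δ * |α - β| ^ 2 := by
  have := norm_sub_sub_smul_sub_smul_le_of_holder hz.hasDerivAt hz.hasDerivAt_deriv hz.nonneg hδ
    hz.holder α β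
  rwa [Complex.real_smul, Complex.real_smul, Complex.ofReal_div, Complex.ofReal_pow,
    Complex.ofReal_ofNat] at this

lemma norm_trapezoid_error_le (hz : HolderCurveBound δ M z) (hδ : 0 ≤ δ) (α β : ℝ) :
    ‖(α - β : ℝ) * (deriv z α + deriv z β) - 2 * (z α - z β)‖ ≤
      3 * M * |α - β| ^ δ * |α - β| ^ 2 := by
  set s := α - β
  have hsplit : s * (deriv z α + deriv z β) - 2 * (z α - z β) =
      s * (deriv z α - deriv z β - s * deriv (deriv z) β) -
        2 * (z α - z β - s * deriv z β - (s : ℂ) ^ 2 / 2 * deriv (deriv z) β) := by ring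
  calc ‖s * (deriv z α + deriv z β) - 2 * (z α - z β)‖
      ≤ |s| * ‖deriv z α - deriv z β - s * deriv (deriv z) β‖ +
          2 * ‖z α - z β - s * deriv z β - (s : ℂ) ^ 2 / 2 * deriv (deriv z) β‖ := by
        rw [hsplit]
        refine (norm_sub_le _ _).trans_eq ?_
        rw [norm_mul, norm_mul, Complex.norm_real, Real.norm_eq_abs, Complex.norm_ofNat]
    _ ≤ |s| * (M * |s| ^ δ * |s|) + 2 * (M * |s| ^ δ * |s| ^ 2) := by
        gcongr
        · exact hz.norm_deriv_sub_sub_mul_le hδ α β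
        · exact hz.norm_sub_sub_mul_sub_mul_le hδ α β
    _ = 3 * M * |s| ^ δ * |s| ^ 2 := by ring

end HolderCurveBound

/-! ### Dominating functions -/

lemma le_mul_cauchyWeight {a f R s : ℝ} (hR : 0 < R) (ha : 0 ≤ a) (hnear : |s| < R → f ≤ a)
    (hfar : R ≤ |s| → f * s ^ 2 ≤ a * R ^ 2) : f ≤ 2 * a * cauchyWeight R s := by
  have hweight : cauchyWeight R s = R ^ 2 / (R ^ 2 + s ^ 2) := by
    rw [cauchyWeight]
    field_simp
  rw [hweight, ← mul_div_assoc, le_div_iff₀ (by positivity)]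
  rcases lt_or_ge |s| R with h | h
  · have hsq : s ^ 2 ≤ R ^ 2 := by
      rw [← sq_abs]
      gcongr
    calc f * (R ^ 2 + s ^ 2) ≤ a * (R ^ 2 + R ^ 2) := by
          gcongr
          exact hnear h
      _ = 2 * a * R ^ 2 := by ring
  · have hsq : R ^ 2 ≤ s ^ 2 := by
      rw [← sq_abs s]
      gcongr
    rcases le_total f 0 with hf | hf
    · exact (mul_nonpos_of_nonpos_of_nonneg hf (by positivity)).trans (by positivity)
    · linarith [hfar h, mul_le_mul_of_nonneg_left hsq hf]

/-- The integrable singularity `|s|^{δ-1}`, cut off at `|s| = 1`. -/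
noncomputable def cutPower (δ s : ℝ) : ℝ := if |s| ≤ 1 then |s| ^ (δ - 1) else 0

lemma measurable_cutPower (δ : ℝ) : Measurable (cutPower δ) :=
  Measurable.ite (measurableSet_le measurable_abs measurable_const)
    (measurable_abs.pow_const _) measurable_const

lemma cutPower_nonneg (δ s : ℝ) : 0 ≤ cutPower δ s := by
  unfold cutPower
  split_ifs <;> positivity

lemma integral_cutPower {δ : ℝ} (hδ : 0 < δ) : ∫ s, cutPower δ s = 2 / δ := by
  have hind : (fun t : ℝ => if t ≤ 1 then t ^ (δ - 1) else 0) =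
      (Iic 1).indicator fun t : ℝ => t ^ (δ - 1) := rfl
  have hhalf : ∫ t in Ioi (0 : ℝ), (if t ≤ 1 then t ^ (δ - 1) else 0) = 1 / δ := by
    rw [hind, setIntegral_indicator measurableSet_Iic, Ioi_inter_Iic,
      ← intervalIntegral.integral_of_le zero_le_one, integral_rpow (Or.inl (by linarith))]
    simp [hδ.ne']
  have habs := integral_comp_abs (f := fun t : ℝ => if t ≤ 1 then t ^ (δ - 1) else 0)
  rw [hhalf, mul_one_div] at habs
  exact habs

lemma integrable_cutPower {δ : ℝ} (hδ : 0 < δ) : Integrable (cutPower δ) :=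
  .of_integral_ne_zero (by rw [integral_cutPower hδ]; positivity)

/-! ### The kernels of the entries -/

/-- The kernel `(x(α) - y(β))^⊥ · ∂y(β) / |x(α) - y(β)|²` of `adjEntry x y`, which in complex
notation is `Im (∂y(β) / (x(α) - y(β)))`. -/
noncomputable def adjKernel (x y : ℝ → ℂ) (α β : ℝ) : ℝ := (deriv y β / (x α - y β)).im

/-- The derivative of `adjKernel x y α β` with respect to `α`, off the set `x α = y β`. -/
noncomputable def adjKernelDeriv (x y : ℝ → ℂ) (α β : ℝ) : ℝ :=
  (-(deriv y β * deriv x α) / (x α - y β) ^ 2).im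

lemma adjIntegrand_eq (x y : ℝ → ℂ) (u : ℝ → ℝ) (α : ℝ) :
    adjIntegrand x y u α = fun β => adjKernel x y α β * u β := by
  funext β
  unfold adjIntegrand adjKernel
  congr 1
  rw [Complex.inner, Complex.div_im, ← Complex.normSq_eq_norm_sq]
  simp only [map_mul, Complex.conj_I, Complex.mul_re, Complex.mul_im, Complex.neg_re,
    Complex.neg_im, Complex.I_re, Complex.I_im, Complex.conj_re, Complex.conj_im]
  ring

lemma abs_im_le_norm_sub_ofReal (w : ℂ) (t : ℝ) : |w.im| ≤ ‖w - t‖ := by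
  simpa using Complex.abs_im_le_norm (w - t)

section AdjKernel

variable {x y : ℝ → ℂ}

lemma measurable_adjKernel (hx : Continuous x) (hy : Continuous y) :
    Measurable (Function.uncurry (adjKernel x y)) :=
  Complex.measurable_im.comp (((measurable_deriv y).comp measurable_snd).div
    ((hx.measurable.comp measurable_fst).sub (hy.measurable.comp measurable_snd)))

lemma measurable_adjKernelDeriv (hx : Continuous x) (hy : Continuous y) :
    Measurable (Function.uncurry (adjKernelDeriv x y)) :=
  Complex.measurable_im.comp
    (((((measurable_deriv y).comp measurable_snd).mul
      ((measurable_deriv x).comp measurable_fst)).neg).div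
    (((hx.measurable.comp measurable_fst).sub (hy.measurable.comp measurable_snd)).pow_const 2))

lemma adjKernel_add_period (hx : IsPeriodicCurve x) (hy : IsPeriodicCurve y) (α β : ℝ) :
    adjKernel x y (α + 2 * π) (β + 2 * π) = adjKernel x y α β := by
  rw [adjKernel, hx.add_sub_add hy, hy.periodic_deriv, adjKernel]

lemma adjKernelDeriv_add_period (hx : IsPeriodicCurve x) (hy : IsPeriodicCurve y) (α β : ℝ) :
    adjKernelDeriv x y (α + 2 * π) (β + 2 * π) = adjKernelDeriv x y α β := by
  rw [adjKernelDeriv, hx.add_sub_add hy, hy.periodic_deriv, hx.periodic_deriv, adjKernelDeriv]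

lemma hasDerivAt_adjKernel {α β : ℝ} (hx : DifferentiableAt ℝ x α) (h : x α - y β ≠ 0) :
    HasDerivAt (fun a => adjKernel x y a β) (adjKernelDeriv x y α β) α := by
  have hquot : HasDerivAt (fun a => deriv y β / (x a - y β))
      (-(deriv y β * deriv x α) / (x α - y β) ^ 2) α :=
    ((hasDerivAt_const α (deriv y β)).div (hx.hasDerivAt.sub_const (y β)) h).congr_deriv (by simp)
  exact Complex.imCLM.hasFDerivAt.comp_hasDerivAt α hquot

end AdjKernel

namespace CurveBound

variable {M N c t : ℝ} {x y : ℝ → ℂ} {α β : ℝ}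

lemma abs_im_deriv_le (hy : CurveBound N y) (β : ℝ) : |(deriv y β).im| ≤ N :=
  (Complex.abs_im_le_norm _).trans (hy.norm_deriv β)

lemma abs_adjKernel_mul_le (hy : CurveBound N y) (hc : 0 ≤ c) (ht : t ≤ c * ‖x α - y β‖) :
    |adjKernel x y α β| * t ≤ c * N := by
  have him : |adjKernel x y α β| ≤ ‖deriv y β‖ / ‖x α - y β‖ := by
    rw [← norm_div]
    exact Complex.abs_im_le_norm _
  calc |adjKernel x y α β| * t
      ≤ ‖deriv y β‖ / ‖x α - y β‖ * (c * ‖x α - y β‖) :=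
        (mul_le_mul_of_nonneg_left ht (abs_nonneg _)).trans
          (mul_le_mul_of_nonneg_right him (by positivity))
    _ = c * ‖deriv y β‖ * (‖x α - y β‖ / ‖x α - y β‖) := by ring
    _ ≤ c * N * 1 := by
        gcongr
        · exact mul_nonneg hc hy.nonneg
        · exact hy.norm_deriv β
        · exact div_self_le_one _
    _ = c * N := mul_one _

lemma abs_adjKernelDeriv_mul_le (hx : CurveBound M x) (hy : CurveBound N y) (hc : 0 ≤ c)
    (ht : t ≤ c * ‖x α - y β‖ ^ 2) : |adjKernelDeriv x y α β| * t ≤ c * (M * N) := by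
  have him : |adjKernelDeriv x y α β| ≤ ‖deriv x α‖ * ‖deriv y β‖ / ‖x α - y β‖ ^ 2 := by
    refine (Complex.abs_im_le_norm _).trans_eq ?_
    rw [norm_div, norm_neg, norm_mul, norm_pow, mul_comm]
  calc |adjKernelDeriv x y α β| * t
      ≤ ‖deriv x α‖ * ‖deriv y β‖ / ‖x α - y β‖ ^ 2 * (c * ‖x α - y β‖ ^ 2) :=
        (mul_le_mul_of_nonneg_left ht (abs_nonneg _)).trans
          (mul_le_mul_of_nonneg_right him (by positivity))
    _ = c * (‖deriv x α‖ * ‖deriv y β‖) * (‖x α - y β‖ ^ 2 / ‖x α - y β‖ ^ 2) := by ring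
    _ ≤ c * (M * N) * 1 := by
        have := hx.nonneg
        have := hy.nonneg
        gcongr
        · exact hx.norm_deriv α
        · exact hy.norm_deriv β
        · exact div_self_le_one _
    _ = c * (M * N) := mul_one _

lemma abs_adjKernel_sub_mul_inv_mul_sq_le (hx : CurveBound M x) (hy : CurveBound N y)
    (hαβ : α ≠ β) (hc : |α - β| ≤ c * ‖x α - y β‖) :
    |adjKernel x y α β - (deriv y β).im * (α - β)⁻¹| * (α - β) ^ 2 ≤ 2 * N * (M + N) * c := by
  set s := α - β with hs
  have hs0 : s ≠ 0 := sub_ne_zero.2 hαβ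
  have hsC : (s : ℂ) ≠ 0 := mod_cast hs0
  have hM := hx.nonneg
  have hN := hy.nonneg
  have hΔ : x α - y β ≠ 0 := fun h0 => by
    rw [h0, norm_zero, mul_zero] at hc
    exact hs0 (abs_nonpos_iff.1 hc)
  have hquot : adjKernel x y α β - (deriv y β).im * s⁻¹ =
      (deriv y β * -(x α - y β - s) / ((x α - y β) * s)).im := by
    have hsplit : deriv y β * -(x α - y β - s) / ((x α - y β) * s) =
        deriv y β / (x α - y β) - (s⁻¹ : ℝ) * deriv y β := by
      rw [Complex.ofReal_inv]
      field_simp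
      ring
    rw [hsplit, Complex.sub_im, Complex.im_ofReal_mul, mul_comm, adjKernel]
  have him : |adjKernel x y α β - (deriv y β).im * s⁻¹| ≤
      N * (2 * (M + N)) / (‖x α - y β‖ * |s|) := by
    rw [hquot]
    refine (Complex.abs_im_le_norm _).trans ?_
    rw [norm_div, norm_mul, norm_mul, norm_neg, Complex.norm_real, Real.norm_eq_abs]
    gcongr
    · exact hy.norm_deriv β
    · exact hx.norm_sub_sub_ofReal_le hy α β
  calc |adjKernel x y α β - (deriv y β).im * s⁻¹| * s ^ 2
      ≤ N * (2 * (M + N)) / (‖x α - y β‖ * |s|) * (|s| * (c * ‖x α - y β‖)) := by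
        rw [← sq_abs, sq |s|]
        gcongr
    _ = 2 * N * (M + N) * c := by
        have := norm_ne_zero_iff.2 hΔ
        have := abs_ne_zero.2 hs0
        field_simp

lemma abs_adjKernel_sub_stepRecip_mul_sq_le (hx : CurveBound M x) (hy : CurveBound N y)
    (hs : 2 * π ≤ |α - β|) (hc : |α - β| ≤ c * ‖x α - y β‖) :
    |adjKernel x y α β - (deriv y β).im * stepRecip (2 * π) (α - β)| * (α - β) ^ 2 ≤
      2 * N * (M + N) * c + 4 * π * N := by
  have hpi := Real.two_pi_pos
  have hαβ : α ≠ β := sub_ne_zero.1 (abs_pos.1 (hpi.trans_le hs))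
  have hsq : 0 < (α - β) ^ 2 := sq_pos_of_ne_zero (sub_ne_zero.2 hαβ)
  have hstep : |(α - β)⁻¹ - stepRecip (2 * π) (α - β)| * (α - β) ^ 2 ≤ 4 * π :=
    ((le_div_iff₀ hsq).1 (abs_inv_sub_stepRecip_le hpi hs)).trans_eq (by ring)
  calc |adjKernel x y α β - (deriv y β).im * stepRecip (2 * π) (α - β)| * (α - β) ^ 2
      ≤ (|adjKernel x y α β - (deriv y β).im * (α - β)⁻¹| +
          |(deriv y β).im * (α - β)⁻¹ - (deriv y β).im * stepRecip (2 * π) (α - β)|) *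
            (α - β) ^ 2 := by
        gcongr
        exact abs_sub_le _ _ _
    _ = |adjKernel x y α β - (deriv y β).im * (α - β)⁻¹| * (α - β) ^ 2 +
          |(α - β)⁻¹ - stepRecip (2 * π) (α - β)| * (α - β) ^ 2 * |(deriv y β).im| := by
        rw [← mul_sub, abs_mul]
        ring
    _ ≤ 2 * N * (M + N) * c + 4 * π * N :=
        add_le_add (hx.abs_adjKernel_sub_mul_inv_mul_sq_le hy hαβ hc)
          (mul_le_mul hstep (hy.abs_im_deriv_le β) (abs_nonneg _) (by positivity))

end CurveBound

/-! ### The kernel of a curve with itself -/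

namespace ChordBound

variable {F : ℝ} {z : ℝ → ℂ}

lemma nonneg (hF : ChordBound F z) : 0 ≤ F := zero_le_one.trans hF.one_le

lemma abs_sub_le (hF : ChordBound F z) (α β : ℝ) : |α - β| ≤ F * ‖z α - z β‖ :=
  le_mul_of_sq_le_mul_sq hF.one_le (norm_nonneg _) (by rw [sq_abs]; exact hF.chord α β)

lemma sub_ne_zero (hF : ChordBound F z) {α β : ℝ} (h : α ≠ β) : z α - z β ≠ 0 := fun h0 => by
  have hle := hF.abs_sub_le α β
  rw [h0, norm_zero, mul_zero] at hle
  exact h (sub_eq_zero.1 (abs_nonpos_iff.1 hle))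

end ChordBound

namespace HolderCurveBound

variable {δ M F : ℝ} {z : ℝ → ℂ} {α β : ℝ}

lemma abs_adjKernel_self_le (hz : HolderCurveBound δ M z) (hF : ChordBound F z) (α β : ℝ) :
    |adjKernel z z α β| ≤ M * F := by
  have hM := hz.nonneg
  have hF0 := hF.nonneg
  rcases eq_or_ne α β with rfl | hαβ
  · simp only [adjKernel, sub_self, div_zero, Complex.zero_im, abs_zero]
    positivity
  have hs : α - β ≠ 0 := sub_ne_zero.2 hαβ
  have hsC : ((α - β : ℝ) : ℂ) ≠ 0 := mod_cast hs
  have : 0 < |α - β| := abs_pos.2 hs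
  have hΔ := hF.sub_ne_zero hαβ
  have := norm_pos_iff.2 hΔ
  have hsub : deriv z β / (z α - z β) - ((α - β)⁻¹ : ℝ) =
      -(z α - z β - (α - β : ℝ) * deriv z β) / ((z α - z β) * (α - β : ℝ)) := by
    rw [Complex.ofReal_inv]
    field_simp
    ring
  -- The singular part `1 / (α - β)` of the complex quotient is real.
  refine (abs_im_le_norm_sub_ofReal _ (α - β)⁻¹).trans ?_
  rw [hsub, norm_div, norm_neg, norm_mul, Complex.norm_real, Real.norm_eq_abs,
    div_le_iff₀ (by positivity)]
  calc ‖z α - z β - (α - β : ℝ) * deriv z β‖ ≤ M * |α - β| ^ 2 :=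
        hz.norm_sub_sub_mul_deriv_le α β
    _ = M * |α - β| * |α - β| := by ring
    _ ≤ M * (F * ‖z α - z β‖) * |α - β| := by
        gcongr
        exact hF.abs_sub_le α β
    _ = M * F * (‖z α - z β‖ * |α - β|) := by ring

lemma abs_adjKernel_self_sub_le (hz : HolderCurveBound δ M z) (hF : ChordBound F z) (α β : ℝ) :
    |adjKernel z z α β - (deriv z β).im * stepRecip (2 * π) (α - β)| ≤
      2 * (M ^ 2 * F) * cauchyWeight (2 * π) (α - β) := by
  have hpi := Real.pi_gt_three
  have hM := hz.one_le
  have hF1 := hF.one_le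
  refine le_mul_cauchyWeight Real.two_pi_pos (by positivity) (fun h => ?_) fun h => ?_
  · rw [stepRecip_eq_zero Real.two_pi_pos h, mul_zero, sub_zero]
    refine (hz.abs_adjKernel_self_le hF α β).trans ?_
    gcongr
    exact le_self_pow₀ hM two_ne_zero
  · refine (hz.abs_adjKernel_sub_stepRecip_mul_sq_le hz.toCurveBound h
      (hF.abs_sub_le α β)).trans ?_
    calc 2 * M * (M + M) * F + 4 * π * M ≤ 4 * (M ^ 2 * F) + 4 * M * (M * F) := by
          have := hz.pi_le
          rw [show 2 * M * (M + M) * F = 4 * (M ^ 2 * F) by ring]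
          gcongr
          exact le_mul_of_one_le_right (by positivity) hF1
      _ = M ^ 2 * F * 8 := by ring
      _ ≤ M ^ 2 * F * (2 * π) ^ 2 := by
          gcongr
          nlinarith

lemma norm_sq_mul_deriv_mul_deriv_sub_sq_le (hz : HolderCurveBound δ M z) (hδ : 0 < δ)
    (hδ_one : δ ≤ 1) (h : |α - β| ≤ 1) :
    ‖((α - β : ℝ) : ℂ) ^ 2 * (deriv z β * deriv z α) - (z α - z β) ^ 2‖ ≤
      5 * M ^ 2 * |α - β| ^ δ * |α - β| ^ 3 := by
  have hM := hz.nonneg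
  have hrδ : |α - β| ≤ |α - β| ^ δ := by
    simpa using Real.rpow_le_rpow_of_exponent_ge' (abs_nonneg _) h hδ.le hδ_one
  set Δ := z α - z β with hΔ
  set s : ℂ := ((α - β : ℝ) : ℂ) with hs
  set r := |α - β|
  -- Each factor differs from `Δ` by `O(r²)` only, but the errors cancel to higher order.
  set a := s * deriv z α - Δ with ha
  set b := s * deriv z β - Δ
  have hsplit : s ^ 2 * (deriv z β * deriv z α) - Δ ^ 2 = Δ * (a + b) + a * b := by ring
  have ha_le : ‖a‖ ≤ M * r ^ 2 := by
    have := hz.norm_sub_sub_mul_deriv_le β α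
    rw [abs_sub_comm] at this
    convert this using 2
    rw [ha, hΔ, hs]
    push_cast
    ring
  have hb_le : ‖b‖ ≤ M * r ^ 2 := by
    rw [norm_sub_rev]
    exact hz.norm_sub_sub_mul_deriv_le α β
  have hab_le : ‖a + b‖ ≤ 3 * M * r ^ δ * r ^ 2 := by
    convert hz.norm_trapezoid_error_le hδ.le α β using 2
    ring
  calc ‖s ^ 2 * (deriv z β * deriv z α) - Δ ^ 2‖ ≤ ‖Δ‖ * ‖a + b‖ + ‖a‖ * ‖b‖ := by
        rw [hsplit, ← norm_mul, ← norm_mul]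
        exact norm_add_le _ _
    _ ≤ M * r * (3 * M * r ^ δ * r ^ 2) + M * r ^ 2 * (M * r ^ 2) := by
        gcongr
        exact hz.norm_sub_le α β
    _ = 3 * M ^ 2 * r ^ δ * r ^ 3 + M ^ 2 * r * r ^ 3 := by ring
    _ ≤ 3 * M ^ 2 * r ^ δ * r ^ 3 + 2 * (M ^ 2 * r ^ δ * r ^ 3) := by
        have : M ^ 2 * r * r ^ 3 ≤ M ^ 2 * r ^ δ * r ^ 3 := by gcongr
        have : 0 ≤ M ^ 2 * r ^ δ * r ^ 3 := by positivity
        linarith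
    _ = 5 * M ^ 2 * r ^ δ * r ^ 3 := by ring

end HolderCurveBound

namespace HolderCurveBound

variable {δ M F : ℝ} {z : ℝ → ℂ} {α β : ℝ}

lemma abs_adjKernelDeriv_self_le_cutPower (hz : HolderCurveBound δ M z) (hF : ChordBound F z)
    (hδ : 0 < δ) (hδ_one : δ ≤ 1) (hαβ : α ≠ β) (h : |α - β| ≤ 1) :
    |adjKernelDeriv z z α β| ≤ 5 * (M ^ 2 * F) * cutPower δ (α - β) := by
  have := hz.nonneg
  have hs : α - β ≠ 0 := sub_ne_zero.2 hαβ
  have hsC : ((α - β : ℝ) : ℂ) ≠ 0 := mod_cast hs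
  have hs_pos : 0 < |α - β| := abs_pos.2 hs
  have hΔ := hF.sub_ne_zero hαβ
  have := norm_pos_iff.2 hΔ
  have hsub : -(deriv z β * deriv z α) / (z α - z β) ^ 2 - ((-((α - β) ^ 2)⁻¹ : ℝ) : ℂ) =
      -(((α - β : ℝ) : ℂ) ^ 2 * (deriv z β * deriv z α) - (z α - z β) ^ 2) /
        ((z α - z β) ^ 2 * ((α - β : ℝ) : ℂ) ^ 2) := by
    rw [Complex.ofReal_neg, Complex.ofReal_inv, Complex.ofReal_pow]
    field_simp
    ring
  have hchord : |α - β| ^ 2 ≤ F * ‖z α - z β‖ ^ 2 := (sq_abs _).trans_le (hF.chord α β)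
  have hpow : |α - β| ^ δ = |α - β| ^ (δ - 1) * |α - β| := by
    rw [Real.rpow_sub_one hs_pos.ne', div_mul_cancel₀ _ hs_pos.ne']
  -- The singular part `-1 / (α - β)²` of the complex quotient is real.
  refine (abs_im_le_norm_sub_ofReal _ (-((α - β) ^ 2)⁻¹)).trans ?_
  rw [hsub, norm_div, norm_neg, norm_mul, norm_pow, norm_pow, Complex.norm_real, Real.norm_eq_abs,
    div_le_iff₀ (by positivity), cutPower, if_pos h]
  calc ‖((α - β : ℝ) : ℂ) ^ 2 * (deriv z β * deriv z α) - (z α - z β) ^ 2‖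
      ≤ 5 * M ^ 2 * |α - β| ^ δ * |α - β| ^ 3 :=
        hz.norm_sq_mul_deriv_mul_deriv_sub_sq_le hδ hδ_one h
    _ = 5 * M ^ 2 * |α - β| ^ (δ - 1) * |α - β| ^ 2 * |α - β| ^ 2 := by
        rw [hpow]
        ring
    _ ≤ 5 * M ^ 2 * |α - β| ^ (δ - 1) * (F * ‖z α - z β‖ ^ 2) * |α - β| ^ 2 := by gcongr
    _ = 5 * (M ^ 2 * F) * |α - β| ^ (δ - 1) * (‖z α - z β‖ ^ 2 * |α - β| ^ 2) := by ring

lemma abs_adjKernelDeriv_self_le (hz : HolderCurveBound δ M z) (hF : ChordBound F z)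
    (hδ : 0 < δ) (hδ_one : δ ≤ 1) (α β : ℝ) :
    |adjKernelDeriv z z α β| ≤
      5 * (M ^ 2 * F) * cutPower δ (α - β) + 2 * (M ^ 2 * F) * cauchyWeight 1 (α - β) := by
  have hF0 := hF.nonneg
  have hcut := cutPower_nonneg δ (α - β)
  have hweight := cauchyWeight_pos 1 (α - β)
  rcases eq_or_ne α β with rfl | hαβ
  · have hdiag : adjKernelDeriv z z α α = 0 := by simp [adjKernelDeriv]
    rw [hdiag, abs_zero]
    positivity
  rcases le_or_gt |α - β| 1 with h | h
  · exact (hz.abs_adjKernelDeriv_self_le_cutPower hF hδ hδ_one hαβ h).trans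
      (le_add_of_nonneg_right (by positivity))
  · refine le_trans ?_ (le_add_of_nonneg_left (by positivity))
    refine le_mul_cauchyWeight one_pos (by positivity) (fun h' => absurd h' h.not_gt) fun _ => ?_
    exact (hz.abs_adjKernelDeriv_mul_le hz.toCurveBound hF0 (hF.chord α β)).trans_eq (by ring)

lemma tendsto_taylor_remainder_div_sq (hz : HolderCurveBound δ M z) (hδ : 0 < δ) (β : ℝ) :
    Tendsto (fun a : ℝ => (z a - z β - (a - β : ℝ) * deriv z β) / ((a - β : ℝ) : ℂ) ^ 2) (𝓝[≠] β)
      (𝓝 (deriv (deriv z) β / 2)) := by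
  have hlim : Tendsto (fun a : ℝ => M * |a - β| ^ δ) (𝓝[≠] β) (𝓝 0) := by
    have hcont : Continuous fun a : ℝ => M * |a - β| ^ δ :=
      continuous_const.mul ((continuous_id.sub continuous_const).abs.rpow_const
        fun _ => Or.inr hδ.le)
    have hval := hcont.tendsto β
    rw [sub_self, abs_zero, Real.zero_rpow hδ.ne', mul_zero] at hval
    exact hval.mono_left nhdsWithin_le_nhds
  rw [tendsto_iff_norm_sub_tendsto_zero]
  refine squeeze_zero' (Eventually.of_forall fun a => norm_nonneg _) ?_ hlim
  filter_upwards [self_mem_nhdsWithin] with a ha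
  have hs : a - β ≠ 0 := sub_ne_zero.2 ha
  have hsC : ((a - β : ℝ) : ℂ) ≠ 0 := mod_cast hs
  have := abs_pos.2 hs
  have hsub : (z a - z β - (a - β : ℝ) * deriv z β) / ((a - β : ℝ) : ℂ) ^ 2 -
      deriv (deriv z) β / 2 = (z a - z β - (a - β : ℝ) * deriv z β -
        ((a - β : ℝ) : ℂ) ^ 2 / 2 * deriv (deriv z) β) / ((a - β : ℝ) : ℂ) ^ 2 := by
    field_simp
  rw [hsub, norm_div, norm_pow, Complex.norm_real, Real.norm_eq_abs, div_le_iff₀ (by positivity)]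
  exact hz.norm_sub_sub_mul_sub_mul_le hδ.le a β

lemma tendsto_adjKernel_self (hz : HolderCurveBound δ M z) (hF : ChordBound F z) (hδ : 0 < δ)
    (β : ℝ) :
    Tendsto (fun a => adjKernel z z a β) (𝓝[≠] β)
      (𝓝 (-(deriv (deriv z) β / 2) / deriv z β).im) := by
  have hslope : Tendsto (fun a : ℝ => (z a - z β) / ((a - β : ℝ) : ℂ)) (𝓝[≠] β)
      (𝓝 (deriv z β)) :=
    (hasDerivAt_iff_tendsto_slope.1 (hz.hasDerivAt β)).congr fun a => by
      rw [slope_def_module, Complex.real_smul, Complex.ofReal_inv, inv_mul_eq_div]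
  have hquot := (hz.tendsto_taylor_remainder_div_sq hδ β).neg.div hslope (hF.deriv_ne_zero β)
  refine ((Complex.continuous_im.tendsto _).comp hquot).congr' ?_
  filter_upwards [self_mem_nhdsWithin] with a ha
  have hs : a - β ≠ 0 := sub_ne_zero.2 ha
  have hsC : ((a - β : ℝ) : ℂ) ≠ 0 := mod_cast hs
  have hΔ := hF.sub_ne_zero ha
  have hsub : -((z a - z β - (a - β : ℝ) * deriv z β) / ((a - β : ℝ) : ℂ) ^ 2) /
      ((z a - z β) / ((a - β : ℝ) : ℂ)) = deriv z β / (z a - z β) - ((a - β)⁻¹ : ℝ) := by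
    rw [Complex.ofReal_inv]
    field_simp
    ring
  rw [Function.comp_apply, Pi.div_apply, hsub, Complex.sub_im, Complex.ofReal_im, sub_zero,
    adjKernel]

lemma isSmoothingKernel (hz : HolderCurveBound δ M z) (hF : ChordBound F z) (hδ : 0 < δ)
    (hδ_one : δ ≤ 1) :
    IsSmoothingKernel (2 * π) (adjKernel z z) (adjKernelDeriv z z) (fun β => (deriv z β).im)
      (2 * (M ^ 2 * F)) (2 * π)
      (fun s => 5 * (M ^ 2 * F) * cutPower δ s + 2 * (M ^ 2 * F) * cauchyWeight 1 s) where
  measurable_kernel := measurable_adjKernel hz.continuous hz.continuous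
  periodic_kernel := adjKernel_add_period hz.periodic hz.periodic
  continuous_coeff := Complex.continuous_im.comp hz.continuous_deriv
  periodic_coeff := hz.periodic.periodic_deriv.comp Complex.im
  radius_ne_zero := Real.two_pi_pos.ne'
  remainder_le := hz.abs_adjKernel_self_sub_le hF
  dominated_deriv :=
    { measurable := measurable_adjKernelDeriv hz.continuous hz.continuous
      periodic := adjKernelDeriv_add_period hz.periodic hz.periodic
      measurable_bound :=
        ((measurable_cutPower δ).const_mul _).add ((measurable_cauchyWeight 1).const_mul _)
      integrable_bound := ((integrable_cutPower hδ).const_mul _).add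
        ((integrable_cauchyWeight one_ne_zero).const_mul _)
      le_bound := hz.abs_adjKernelDeriv_self_le hF hδ hδ_one }
  hasDerivAt α _ h := hasDerivAt_adjKernel (hz.hasDerivAt α).differentiableAt (hF.sub_ne_zero h)
  exists_limit β := ⟨_, hz.tendsto_adjKernel_self hF hδ β⟩

end HolderCurveBound

/-! ### The kernel of two separated curves -/

namespace IsSeparated

variable {D : ℝ} {x y : ℝ → ℂ}

lemma nonneg (hd : IsSeparated D x y) : 0 ≤ D := zero_le_one.trans hd.one_le

lemma one_le_mul_norm (hd : IsSeparated D x y) (α β : ℝ) : 1 ≤ D * ‖x α - y β‖ :=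
  le_mul_of_sq_le_mul_sq hd.one_le (norm_nonneg _) (by rw [one_pow]; exact hd.one_le_mul α β)

lemma sub_ne_zero (hd : IsSeparated D x y) (α β : ℝ) : x α - y β ≠ 0 := fun h0 => by
  have hle := hd.one_le_mul_norm α β
  rw [h0, norm_zero, mul_zero] at hle
  exact zero_lt_one.not_ge hle

end IsSeparated

namespace CurveBound

variable {M N D : ℝ} {x y : ℝ → ℂ}

lemma abs_sub_le_two_mul_norm (hx : CurveBound M x) (hy : CurveBound N y) {α β : ℝ}
    (h : 4 * (M + N) ≤ |α - β|) : |α - β| ≤ 2 * ‖x α - y β‖ := by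
  have hdev := hx.norm_sub_sub_ofReal_le hy α β
  have htri := norm_sub_norm_le ((α - β : ℝ) : ℂ) (x α - y β)
  rw [norm_sub_rev ((α - β : ℝ) : ℂ), Complex.norm_real, Real.norm_eq_abs] at htri
  linarith

lemma abs_adjKernel_sub_le (hx : CurveBound M x) (hy : CurveBound N y) (hd : IsSeparated D x y)
    (α β : ℝ) :
    |adjKernel x y α β - (deriv y β).im * stepRecip (2 * π) (α - β)| ≤
      2 * (2 * (N * D)) * cauchyWeight (4 * (M + N)) (α - β) := by
  have hpi := Real.pi_gt_three
  have hM := hx.pi_le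
  have hN := hy.pi_le
  have hD := hd.one_le
  have hN0 := hy.nonneg
  refine le_mul_cauchyWeight (by linarith) (by positivity) (fun _ => ?_) fun h => ?_
  · have hkernel : |adjKernel x y α β| ≤ D * N := by
      simpa using hy.abs_adjKernel_mul_le hd.nonneg (hd.one_le_mul_norm α β)
    have hstep : |(deriv y β).im * stepRecip (2 * π) (α - β)| ≤ N * D := by
      rw [abs_mul]
      have hstep_le := abs_stepRecip_le Real.two_pi_pos (α - β)
      have hinv : (2 * π)⁻¹ ≤ D := (inv_le_one_of_one_le₀ (by linarith)).trans hD
      exact mul_le_mul (hy.abs_im_deriv_le β) (hstep_le.trans hinv) (abs_nonneg _) hN0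
    linarith [abs_sub (adjKernel x y α β) ((deriv y β).im * stepRecip (2 * π) (α - β))]
  · refine (hx.abs_adjKernel_sub_stepRecip_mul_sq_le hy (by linarith)
      (hx.abs_sub_le_two_mul_norm hy h)).trans ?_
    calc 2 * N * (M + N) * 2 + 4 * π * N ≤ 2 * N * (M + N) * 2 + 4 * (M + N) * N := by
          gcongr
          linarith
      _ = 8 * (N * 1) * ((M + N) * 1) := by ring
      _ ≤ 32 * (N * D) * ((M + N) * (M + N)) := by
          gcongr <;> linarith
      _ = 2 * (N * D) * (4 * (M + N)) ^ 2 := by ring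

lemma abs_adjKernelDeriv_le (hx : CurveBound M x) (hy : CurveBound N y) (hd : IsSeparated D x y)
    (α β : ℝ) :
    |adjKernelDeriv x y α β| ≤ 2 * (M * N * D) * cauchyWeight (4 * (M + N)) (α - β) := by
  have hM := hx.one_le
  have hN := hy.one_le
  have hD := hd.one_le
  refine le_mul_cauchyWeight (by linarith) (by positivity) (fun _ => ?_) fun h => ?_
  · have hle := hx.abs_adjKernelDeriv_mul_le hy hd.nonneg (hd.one_le_mul α β)
    rwa [mul_one, mul_comm D] at hle
  · have hsq : (α - β) ^ 2 ≤ 4 * ‖x α - y β‖ ^ 2 := by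
      rw [← sq_abs, show (4 : ℝ) = 2 ^ 2 by norm_num, ← mul_pow]
      gcongr
      exact hx.abs_sub_le_two_mul_norm hy h
    calc |adjKernelDeriv x y α β| * (α - β) ^ 2 ≤ 4 * (M * N) :=
          hx.abs_adjKernelDeriv_mul_le hy (by norm_num) hsq
      _ = M * N * 1 * 2 ^ 2 := by ring
      _ ≤ M * N * D * (4 * (M + N)) ^ 2 := by
          gcongr
          linarith

lemma isSmoothingKernel (hx : CurveBound M x) (hy : CurveBound N y) (hd : IsSeparated D x y) :
    IsSmoothingKernel (2 * π) (adjKernel x y) (adjKernelDeriv x y) (fun β => (deriv y β).im)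
      (2 * (2 * (N * D))) (4 * (M + N))
      (fun s => 2 * (M * N * D) * cauchyWeight (4 * (M + N)) s) := by
  have hR : 4 * (M + N) ≠ 0 := by linarith [hx.one_le, hy.one_le]
  have hderiv : ∀ α β, HasDerivAt (fun a => adjKernel x y a β) (adjKernelDeriv x y α β) α :=
    fun α β => hasDerivAt_adjKernel (hx.hasDerivAt α).differentiableAt (hd.sub_ne_zero α β)
  exact
  { measurable_kernel := measurable_adjKernel hx.continuous hy.continuous
    periodic_kernel := adjKernel_add_period hx.periodic hy.periodic
    continuous_coeff := Complex.continuous_im.comp hy.continuous_deriv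
    periodic_coeff := hy.periodic.periodic_deriv.comp Complex.im
    radius_ne_zero := hR
    remainder_le := hx.abs_adjKernel_sub_le hy hd
    dominated_deriv :=
      { measurable := measurable_adjKernelDeriv hx.continuous hy.continuous
        periodic := adjKernelDeriv_add_period hx.periodic hy.periodic
        measurable_bound := (measurable_cauchyWeight _).const_mul _
        integrable_bound := (integrable_cauchyWeight hR).const_mul _
        le_bound := hx.abs_adjKernelDeriv_le hy hd }
    hasDerivAt := fun α β _ => hderiv α β
    exists_limit := fun β =>
      ⟨_, (hderiv β β).continuousAt.tendsto.mono_left nhdsWithin_le_nhds⟩ }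

end CurveBound

/-! ### The entries as operators from `L²` to `H¹` -/

lemma circleMeasure_eq_restrict : circleMeasure = volume.restrict (Ioc (-π) (-π + 2 * π)) := by
  rw [circleMeasure, show -π + 2 * π = π by ring]

lemma l2Norm_const_mul (c : ℝ) (f : ℝ → ℝ) : l2Norm (fun α => c * f α) = ‖c‖ₑ * l2Norm f :=
  eLpNorm_const_smul c f 2 circleMeasure

namespace MemL2

variable {f g φ : ℝ → ℝ}

lemma integrable (hf : MemL2 f) : Integrable f circleMeasure := by
  have : IsFiniteMeasure circleMeasure :=
    inferInstanceAs (IsFiniteMeasure (volume.restrict (Ioc (-π) π)))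
  exact hf.2.integrable one_le_two

lemma locallyIntegrable (hf : MemL2 f) : LocallyIntegrable f := by
  refine locallyIntegrable_of_periodic Real.two_pi_pos hf.1 (a := -π) ?_
  rw [IntegrableOn, ← circleMeasure_eq_restrict]
  exact hf.integrable

lemma const_mul (hf : MemL2 f) (c : ℝ) : MemL2 fun α => c * f α :=
  ⟨fun x => by simp only [hf.1 x], hf.2.const_mul c⟩

lemma add (hf : MemL2 f) (hg : MemL2 g) : MemL2 fun α => f α + g α := ⟨hf.1.add hg.1, hf.2.add hg.2⟩

lemma integrable_mul (hf : MemL2 f) (hφ : Continuous φ) (hφT : Function.Periodic φ (2 * π)) :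
    Integrable (fun α => f α * φ α) circleMeasure := by
  obtain ⟨B, hB⟩ := (hφT.isBounded_of_continuous Real.two_pi_pos.ne' hφ).exists_norm_le
  exact hf.integrable.mul_bdd (c := B) hφ.aestronglyMeasurable
    (Eventually.of_forall fun α => hB _ (mem_range_self α))

end MemL2

lemma IsWeakDeriv.add {f₁ f₂ g₁ g₂ : ℝ → ℝ} (h₁ : IsWeakDeriv f₁ g₁) (h₂ : IsWeakDeriv f₂ g₂)
    (hf₁ : MemL2 f₁) (hf₂ : MemL2 f₂) (hg₁ : MemL2 g₁) (hg₂ : MemL2 g₂) :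
    IsWeakDeriv (fun α => f₁ α + f₂ α) (fun α => g₁ α + g₂ α) := by
  intro φ hφ hφT
  have hφ' : Continuous (deriv φ) := hφ.continuous_deriv (by simp)
  have hφ'T := periodic_deriv hφT
  simp only [add_mul]
  rw [integral_add (hf₁.integrable_mul hφ' hφ'T) (hf₂.integrable_mul hφ' hφ'T),
    integral_add (hg₁.integrable_mul hφ.continuous hφT) (hg₂.integrable_mul hφ.continuous hφT),
    h₁ φ hφ hφT, h₂ φ hφ hφT]
  ring

lemma IsWeakDeriv.const_mul {f g : ℝ → ℝ} (h : IsWeakDeriv f g) (c : ℝ) :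
    IsWeakDeriv (fun α => c * f α) fun α => c * g α := fun φ hφ hφT => by
  simp only [mul_assoc, integral_const_mul, h φ hφ hφT, mul_neg]

lemma h1Norm_le {f g : ℝ → ℝ} (hg : MemL2 g) (h : IsWeakDeriv f g) :
    h1Norm f ≤ l2Norm f + l2Norm g := by
  refine (iInf₂_le g ⟨hg, h⟩).trans ?_
  have hle := ENNReal.rpow_add_rpow_le_add (l2Norm f) (l2Norm g) one_le_two
  simpa only [ENNReal.rpow_two] using hle

/-- `f` lies in `H¹(𝕋)`, and the `L²` norms of `f` and of a weak derivative of `f` add up to at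
most `B`. -/
def H1Bound (f : ℝ → ℝ) (B : ℝ≥0∞) : Prop :=
  MemL2 f ∧ ∃ g, MemL2 g ∧ IsWeakDeriv f g ∧ l2Norm f + l2Norm g ≤ B

namespace H1Bound

variable {f f₁ f₂ : ℝ → ℝ} {B B₁ B₂ : ℝ≥0∞}

lemma mono (h : H1Bound f B₁) (hB : B₁ ≤ B₂) : H1Bound f B₂ :=
  ⟨h.1, h.2.imp fun _ hg => ⟨hg.1, hg.2.1, hg.2.2.trans hB⟩⟩

lemma memH1 (h : H1Bound f B) : MemH1 f := ⟨h.1, h.2.imp fun _ hg => ⟨hg.1, hg.2.1⟩⟩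

lemma h1Norm_le (h : H1Bound f B) : h1Norm f ≤ B := by
  obtain ⟨-, g, hg, hfg, hB⟩ := h
  exact (Muskat.h1Norm_le hg hfg).trans hB

lemma add (h₁ : H1Bound f₁ B₁) (h₂ : H1Bound f₂ B₂) :
    H1Bound (fun α => f₁ α + f₂ α) (B₁ + B₂) := by
  obtain ⟨hf₁, g₁, hg₁, hfg₁, hB₁⟩ := h₁
  obtain ⟨hf₂, g₂, hg₂, hfg₂, hB₂⟩ := h₂
  refine ⟨hf₁.add hf₂, fun α => g₁ α + g₂ α, hg₁.add hg₂, hfg₁.add hfg₂ hf₁ hf₂ hg₁ hg₂, ?_⟩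
  calc l2Norm (fun α => f₁ α + f₂ α) + l2Norm (fun α => g₁ α + g₂ α)
      ≤ (l2Norm f₁ + l2Norm f₂) + (l2Norm g₁ + l2Norm g₂) :=
        add_le_add (eLpNorm_add_le hf₁.2.1 hf₂.2.1 one_le_two)
          (eLpNorm_add_le hg₁.2.1 hg₂.2.1 one_le_two)
    _ = (l2Norm f₁ + l2Norm g₁) + (l2Norm f₂ + l2Norm g₂) := add_add_add_comm _ _ _ _
    _ ≤ B₁ + B₂ := add_le_add hB₁ hB₂

end H1Bound

namespace IsDominatedKernel

variable {H : ℝ → ℝ → ℝ} {q u : ℝ → ℝ}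

lemma memL2_integral (hH : IsDominatedKernel (2 * π) H q) (hu : MemL2 u) :
    MemL2 fun α => ∫ β, H α β * u β := by
  refine ⟨hH.periodic_integral hu.1, ?_⟩
  have hmem := hu.2
  rw [circleMeasure_eq_restrict] at hmem ⊢
  exact hH.memLp_integral Real.two_pi_pos one_le_two ENNReal.ofNat_ne_top hmem hu.1

lemma l2Norm_const_mul_integral_le (hH : IsDominatedKernel (2 * π) H q) (hu : MemL2 u) (c : ℝ) :
    l2Norm (fun α => c * ∫ β, H α β * u β) ≤ ENNReal.ofReal (|c| * ∫ s, q s) * l2Norm u := by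
  rw [l2Norm_const_mul, ENNReal.ofReal_mul (abs_nonneg c), ← Real.norm_eq_abs, ofReal_norm,
    mul_assoc, l2Norm, l2Norm, circleMeasure_eq_restrict]
  gcongr
  exact hH.eLpNorm_integral_le Real.two_pi_pos one_le_two ENNReal.ofNat_ne_top
    hu.locallyIntegrable.aestronglyMeasurable hu.1

end IsDominatedKernel

namespace IsSmoothingKernel

variable {K K' : ℝ → ℝ → ℝ} {A R : ℝ} {b k u : ℝ → ℝ}

lemma isWeakDeriv (hK : IsSmoothingKernel (2 * π) K K' b A R k) (hu : MemL2 u) :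
    IsWeakDeriv (fun α => pv (fun β => K α β * u β) α) fun α => ∫ β, K' α β * u β := by
  intro φ hφ hφT
  rw [circleMeasure_eq_restrict]
  exact hK.setIntegral_pv_mul_deriv Real.two_pi_pos hu.locallyIntegrable hu.1
    (hφ.of_le (by simp)) hφT

end IsSmoothingKernel

/-- The entry of `𝒯*` from functions on the curve `y` to functions on the curve `x` is given by
convergent principal values and maps `L²(𝕋)` into `H¹(𝕋)` with norm at most `B`. -/
structure AdjEntryBound (x y : ℝ → ℂ) (B : ℝ≥0∞) : Prop where
  exists_hasPV : ∀ {u}, MemL2 u → ∀ α, ∃ v, HasPV (adjIntegrand x y u α) α v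
  h1Bound : ∀ {u}, MemL2 u → H1Bound (adjEntry x y u) (B * l2Norm u)

lemma AdjEntryBound.mono {x y : ℝ → ℂ} {B₁ B₂ : ℝ≥0∞} (h : AdjEntryBound x y B₁) (hB : B₁ ≤ B₂) :
    AdjEntryBound x y B₂ where
  exists_hasPV := h.exists_hasPV
  h1Bound hu := (h.h1Bound hu).mono (by gcongr)

namespace IsSmoothingKernel

variable {x y : ℝ → ℂ} {A R : ℝ} {b k u : ℝ → ℝ}

lemma h1Bound_adjEntry
    (hK : IsSmoothingKernel (2 * π) (adjKernel x y) (adjKernelDeriv x y) b A R k) (hR : 0 < R)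
    (hA : 0 ≤ A) (hu : MemL2 u) :
    H1Bound (adjEntry x y u) (ENNReal.ofReal (A * R + (∫ s, k s) / π) * l2Norm u) := by
  have hc : |-(1 / π)| = 1 / π := by rw [abs_neg, abs_of_pos (by positivity)]
  have hpv : adjEntry x y u = fun α => -(1 / π) * pv (fun β => adjKernel x y α β * u β) α := by
    funext α
    rw [adjEntry, adjIntegrand_eq]
  have hremainder : adjEntry x y u = fun α =>
      -(1 / π) * ∫ β, (adjKernel x y α β - b β * stepRecip (2 * π) (α - β)) * u β := by
    simp only [hpv, hK.pv_eq Real.two_pi_pos hu.locallyIntegrable hu.1]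
  have hk : 0 ≤ ∫ s, k s := integral_nonneg fun s => by
    simpa using (abs_nonneg _).trans (hK.dominated_deriv.le_bound s 0)
  have hnorm := hK.dominated_remainder.l2Norm_const_mul_integral_le hu (-(1 / π))
  rw [← hremainder, hc, integral_const_mul, integral_cauchyWeight hR,
    show 1 / π * (A * (π * R)) = A * R by field_simp] at hnorm
  have hnorm_deriv := hK.dominated_deriv.l2Norm_const_mul_integral_le hu (-(1 / π))
  rw [hc, one_div_mul_eq_div] at hnorm_deriv
  refine ⟨?_, _, (hK.dominated_deriv.memL2_integral hu).const_mul (-(1 / π)), ?_, ?_⟩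
  · rw [hremainder]
    exact (hK.dominated_remainder.memL2_integral hu).const_mul _
  · rw [hpv]
    exact (hK.isWeakDeriv hu).const_mul _
  · rw [ENNReal.ofReal_add (by positivity) (by positivity), add_mul]
    exact add_le_add hnorm hnorm_deriv

lemma adjEntryBound
    (hK : IsSmoothingKernel (2 * π) (adjKernel x y) (adjKernelDeriv x y) b A R k) (hR : 0 < R)
    (hA : 0 ≤ A) : AdjEntryBound x y (ENNReal.ofReal (A * R + (∫ s, k s) / π)) where
  exists_hasPV hu α := by
    rw [adjIntegrand_eq]
    exact ⟨_, hK.hasPV Real.two_pi_pos hu.locallyIntegrable hu.1 α⟩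
  h1Bound := hK.h1Bound_adjEntry hR hA

end IsSmoothingKernel

lemma HolderCurveBound.adjEntryBound {δ M F : ℝ} {z : ℝ → ℂ} (hz : HolderCurveBound δ M z)
    (hF : ChordBound F z) (hδ : 0 < δ) (hδ_one : δ ≤ 1) :
    AdjEntryBound z z (ENNReal.ofReal (20 / δ * (F * M ^ 2))) := by
  have hF0 := hF.nonneg
  have hpi := Real.pi_gt_three
  refine ((hz.isSmoothingKernel hF hδ hδ_one).adjEntryBound Real.two_pi_pos (by positivity)).mono
    (ENNReal.ofReal_le_ofReal ?_)
  rw [integral_add ((integrable_cutPower hδ).const_mul _)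
    ((integrable_cauchyWeight one_ne_zero).const_mul _), integral_const_mul, integral_const_mul,
    integral_cutPower hδ, integral_cauchyWeight one_pos]
  have hδ_inv : 1 ≤ 1 / δ := (one_le_div hδ).2 hδ_one
  have hdiv : 10 / δ / π ≤ 10 / δ / 3 := by gcongr
  calc _ = (4 * π + 10 / δ / π + 2) * (F * M ^ 2) := by
        field_simp
        ring
    _ ≤ 20 / δ * (F * M ^ 2) := by
        gcongr
        have := Real.pi_lt_d2
        rw [← mul_one_div 10] at hdiv ⊢
        rw [← mul_one_div 20]
        linarith

lemma CurveBound.adjEntryBound {M N D : ℝ} {x y : ℝ → ℂ} (hx : CurveBound M x)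
    (hy : CurveBound N y) (hd : IsSeparated D x y) :
    AdjEntryBound x y (ENNReal.ofReal (48 * (D * M ^ 2 * N ^ 2))) := by
  have hM := hx.one_le
  have hN := hy.one_le
  have hD := hd.nonneg
  have hR : 0 < 4 * (M + N) := by linarith
  refine ((hx.isSmoothingKernel hy hd).adjEntryBound hR (by positivity)).mono
    (ENNReal.ofReal_le_ofReal ?_)
  rw [integral_const_mul, integral_cauchyWeight hR]
  have hadd : M + N ≤ 2 * (M * N) := by nlinarith
  calc _ = 16 * D * N * (1 * (M + N)) + 8 * D * M * N * (M + N) := by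
        field_simp
        ring
    _ ≤ 16 * D * N * (M * (2 * (M * N))) + 8 * D * M * N * (2 * (M * N)) := by gcongr
    _ = 48 * (D * M ^ 2 * N ^ 2) := by ring

lemma distNorm_comm (z h : ℝ → ℂ) : distNorm z h = distNorm h z := by
  rw [distNorm, iSup_comm]
  simp only [distNorm, ← enorm_neg (z _ - h _), neg_sub]

/-- The product of the geometric quantities of a pair of curves in the bound for `𝒯*`. -/
noncomputable def pairBound (δ : ℝ) (z h : ℝ → ℂ) : ℝ≥0∞ :=
  arcChordNorm h ^ 2 * holderNorm δ h ^ 2 *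
    (arcChordNorm z ^ 2 * (max 1 (distNorm z h)) ^ 2 * holderNorm δ z ^ 2)

lemma pairBound_comm (δ : ℝ) (z h : ℝ → ℂ) : pairBound δ z h = pairBound δ h z := by
  rw [pairBound, pairBound, distNorm_comm]
  ring

section Pair

variable {δ : ℝ} {z h : ℝ → ℂ}

lemma adjEntryBound_self (hz : IsPeriodicCurve z) (hh : IsPeriodicCurve h) (hzδ : IsC2Holder δ z)
    (hF : arcChordNorm z ≠ ⊤) (hδ : 0 < δ) (hδ_one : δ ≤ 1) :
    AdjEntryBound z z (ENNReal.ofReal (48 / δ) * pairBound δ z h) := by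
  refine ((hzδ.holderCurveBound hz hδ.le).adjEntryBound (hz.chordBound hF) hδ hδ_one).mono ?_
  rw [ENNReal.ofReal_mul (by positivity), ENNReal.ofReal_mul (by positivity),
    ENNReal.ofReal_pow (by positivity), ENNReal.ofReal_toReal hF, ENNReal.ofReal_toReal hzδ.2.ne]
  gcongr
  · norm_num
  calc arcChordNorm z * holderNorm δ z ^ 2
      = 1 * 1 * (arcChordNorm z * 1 * holderNorm δ z ^ 2) := by ring
    _ ≤ pairBound δ z h := by
        rw [pairBound]
        gcongr
        exacts [one_le_pow₀ hh.one_le_arcChordNorm, one_le_pow₀ hh.one_le_holderNorm,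
          le_self_pow₀ hz.one_le_arcChordNorm two_ne_zero, one_le_pow₀ (le_max_left _ _)]

lemma adjEntryBound_pair (hz : IsPeriodicCurve z) (hh : IsPeriodicCurve h) (hzδ : IsC2Holder δ z)
    (hhδ : IsC2Holder δ h) (hd : distNorm z h ≠ ⊤) (hδ : 0 < δ) (hδ_one : δ ≤ 1) :
    AdjEntryBound z h (ENNReal.ofReal (48 / δ) * pairBound δ z h) := by
  refine ((hzδ.holderCurveBound hz hδ.le).toCurveBound.adjEntryBound
    (hhδ.holderCurveBound hh hδ.le).toCurveBound (isSeparated_distNorm hd)).mono ?_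
  rw [ENNReal.ofReal_mul (by positivity), ENNReal.ofReal_mul (by positivity),
    ENNReal.ofReal_mul (by positivity), ENNReal.ofReal_pow (by positivity),
    ENNReal.ofReal_pow (by positivity), ENNReal.ofReal_toReal (max_ne_top ENNReal.one_ne_top hd),
    ENNReal.ofReal_toReal hzδ.2.ne, ENNReal.ofReal_toReal hhδ.2.ne]
  gcongr
  · exact (le_div_iff₀ hδ).2 (by linarith)
  calc max 1 (distNorm z h) * holderNorm δ z ^ 2 * holderNorm δ h ^ 2
      = 1 * holderNorm δ h ^ 2 * (1 * max 1 (distNorm z h) * holderNorm δ z ^ 2) := by ring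
    _ ≤ pairBound δ z h := by
        rw [pairBound]
        gcongr
        exacts [one_le_pow₀ hh.one_le_arcChordNorm, one_le_pow₀ hz.one_le_arcChordNorm,
          le_self_pow₀ (le_max_left _ _) two_ne_zero]

end Pair

end Muskat

theorem mainTheorem6 (δ : ℝ) (hδ : 0 < δ) (hδ1 : δ ≤ 1) :
    ∃ C : ℝ≥0, ∀ z h : ℝ → ℂ,
      Muskat.IsPeriodicCurve z → Muskat.IsPeriodicCurve h →
      Muskat.IsC2Holder δ z → Muskat.IsC2Holder δ h →
      Muskat.arcChordNorm z < ⊤ → Muskat.arcChordNorm h < ⊤ → Muskat.distNorm z h < ⊤ →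
      ∀ u₁ u₂ : ℝ → ℝ, Muskat.MemL2 u₁ → Muskat.MemL2 u₂ →
        (∀ α : ℝ,
          (∃ v, Muskat.HasPV (Muskat.adjIntegrand z z u₁ α) α v) ∧
          (∃ v, Muskat.HasPV (Muskat.adjIntegrand h z u₁ α) α v) ∧
          (∃ v, Muskat.HasPV (Muskat.adjIntegrand z h u₂ α) α v) ∧
          (∃ v, Muskat.HasPV (Muskat.adjIntegrand h h u₂ α) α v)) ∧
        Muskat.MemH1 (Muskat.adjFst z h u₁ u₂) ∧
        Muskat.MemH1 (Muskat.adjSnd z h u₁ u₂) ∧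
        Muskat.h1Norm (Muskat.adjFst z h u₁ u₂) + Muskat.h1Norm (Muskat.adjSnd z h u₁ u₂) ≤
          (C * Muskat.arcChordNorm h ^ 2 * Muskat.holderNorm δ h ^ 2) *
            (Muskat.arcChordNorm z ^ 2 * (max 1 (Muskat.distNorm z h)) ^ 2 *
              Muskat.holderNorm δ z ^ 2) *
            (Muskat.l2Norm u₁ + Muskat.l2Norm u₂) := by
  refine ⟨2 * (48 / δ).toNNReal, fun z h hz hh hzδ hhδ hFz hFh hd u₁ u₂ hu₁ hu₂ => ?_⟩
  have hzz := Muskat.adjEntryBound_self hz hh hzδ hFz.ne hδ hδ1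
  have hzh := Muskat.adjEntryBound_pair hz hh hzδ hhδ hd.ne hδ hδ1
  have hhz := Muskat.adjEntryBound_pair hh hz hhδ hzδ (Muskat.distNorm_comm z h ▸ hd.ne) hδ hδ1
  have hhh := Muskat.adjEntryBound_self hh hz hhδ hFh.ne hδ hδ1
  rw [← Muskat.pairBound_comm δ z h] at hhz hhh
  have hfst := (hzz.h1Bound hu₁).add (hzh.h1Bound hu₂)
  have hsnd := (hhz.h1Bound hu₁).add (hhh.h1Bound hu₂)
  refine ⟨fun α => ⟨hzz.exists_hasPV hu₁ α, hhz.exists_hasPV hu₁ α, hzh.exists_hasPV hu₂ α,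
    hhh.exists_hasPV hu₂ α⟩, hfst.memH1, hsnd.memH1, ?_⟩
  refine (add_le_add hfst.h1Norm_le hsnd.h1Norm_le).trans_eq ?_
  rw [Muskat.pairBound, ENNReal.ofReal, ENNReal.coe_mul, ENNReal.coe_ofNat]
  ring
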